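/- Let $G$ be a connected semisimple real algebraic group, that is, a topological group isomorphic to an open subgroup (in the Euclidean topology) of the group of real points of a Zariski-connected semisimple linear algebraic group over $\mathbb R$ (for instance the whole group of real points, or its identity component). Let $dg$ be a Haar measure on $G$. A unitary representation $(\pi,\mathcal H)$ of $G$ is called tempered if it is weakly contained in the right regular representation $L^2(G,dg)$, i.e. every diagonal matrix coefficient $g\mapsto\langle \pi(g)v,v\rangle$, $v\in\mathcal H$, is a limit, uniformly on compact subsets of $G$, of convex combinations of diagonal matrix coefficients of $L^2(G,dg)$. A closed unimodular subgroup $H<G$ is called tempered if the quasi-regular representation of $G$ by right translations on $L^2(H\backslash G)$, taken with respect to the nonzero $G$-invariant Radon measure on $H\backslash G$ (unique up to scaling), is tempered. A closed subgroup $H$ is the Chabauty limit of a sequence of closed subgroups $\Gamma_n$ of $G$ if every $h\in H$ is the limit of some sequence $h_n\in\Gamma_n$, and all limit points of every sequence $g_n\in\Gamma_n$ belong to $H$. Theorem. Let $(\Gamma_n)_{n\in\mathbb N}$ be a sequence of tempered discrete subgroups of $G$, and let $H$ be a closed subgroup of $G$ which is the Chabauty limit of $(\Gamma_n)$. Then $H$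 is unimodular, and $H$ is a tempered subgroup of $G$. -/

import Mathlib

open MeasureTheory Filter Topology
open scoped ENNReal

noncomputable section

/-! ### Unitary representations, weak containment -/

/-- A (strongly continuous) unitary representation of `G` on a complex inner product space `V`. -/
structure UnitaryRep (G : Type*) [Group G] [TopologicalSpace G]
    (V : Type*) [NormedAddCommGroup V] [InnerProductSpace ℂ V] where
  /-- the action by unitary operators -/
  toHom : G →* (V ≃ₗᵢ[ℂ] V)
  /-- strong continuity -/
  continuous_apply : ∀ v : V, Continuous fun g : G => toHom g v

namespace UnitaryRep

variable {G : Type*} [Group G] [TopologicalSpace G]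
  {V : Type*} [NormedAddCommGroup V] [InnerProductSpace ℂ V]
  {W : Type*} [NormedAddCommGroup W] [InnerProductSpace ℂ W]

/-- The diagonal matrix coefficient `g ↦ ⟨π(g) v, v⟩` (Mathlib's inner product is linear in its
second argument). -/
def diagCoeff (π : UnitaryRep G V) (v : V) : G → ℂ := fun g => inner ℂ v (π.toHom g v)

/-- `π` is weakly contained in `σ`: every diagonal matrix coefficient of `π` is approximated,
uniformly on compact subsets of `G`, by convex combinations of diagonal matrix coefficients
of `σ`. -/
def WeaklyContainedIn (π : UnitaryRep G V) (σ : UnitaryRep G W) : Prop :=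
  ∀ v : V, ∀ Q : Set G, IsCompact Q → ∀ ε : ℝ, 0 < ε →
    ∃ φ ∈ convexHull ℝ (Set.range σ.diagCoeff), ∀ g ∈ Q, ‖π.diagCoeff v g - φ g‖ < ε

end UnitaryRep

/-! ### Right translation on `L²` -/

section RightTranslation

variable {G : Type*} [Group G] [TopologicalSpace G]
  {X : Type*} [TopologicalSpace X] [R1Space X] [MeasurableSpace X] [BorelSpace X]
  [MulAction Gᵐᵒᵖ X] [ContinuousSMul Gᵐᵒᵖ X]

/-- For a right action of `G` on `X` (that is, an action of `Gᵐᵒᵖ`) preserving the Radon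
measure `μ`, the unitary representation of `G` on `L²(X, μ)` by right translations, `(g • f)(x) = f(x g)`.
-/
def rightTranslationRep (μ : Measure X) [μ.Regular] [IsLocallyFiniteMeasure μ]
    [SMulInvariantMeasure Gᵐᵒᵖ X μ] :
    UnitaryRep G (Lp ℂ 2 μ) where
  toHom :=
    { toFun := fun g =>
        { toFun := fun f => DomMulAct.mk (MulOpposite.op g) • f
          invFun := fun f => DomMulAct.mk (MulOpposite.op g⁻¹) • f
          map_add' := fun f₁ f₂ => smul_add _ f₁ f₂
          map_smul' := fun c f => smul_comm _ c f
          left_inv := fun f => by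
            change DomMulAct.mk (MulOpposite.op g⁻¹) • DomMulAct.mk (MulOpposite.op g) • f = f
            rw [smul_smul, ← DomMulAct.mk_mul, ← MulOpposite.op_mul, inv_mul_cancel,
              MulOpposite.op_one, DomMulAct.mk_one, one_smul]
          right_inv := fun f => by
            change DomMulAct.mk (MulOpposite.op g) • DomMulAct.mk (MulOpposite.op g⁻¹) • f = f
            rw [smul_smul, ← DomMulAct.mk_mul, ← MulOpposite.op_mul, mul_inv_cancel,
              MulOpposite.op_one, DomMulAct.mk_one, one_smul]
          norm_map' := fun f => DomMulAct.norm_smul_Lp _ f }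
      map_one' := by
        ext1 f
        exact one_smul (Gᵐᵒᵖ)ᵈᵐᵃ f
      map_mul' := fun g h => by
        ext1 f
        change DomMulAct.mk (MulOpposite.op (g * h)) • f
          = DomMulAct.mk (MulOpposite.op g) • DomMulAct.mk (MulOpposite.op h) • f
        rw [smul_smul, ← DomMulAct.mk_mul, ← MulOpposite.op_mul] }
  continuous_apply := fun f => by
    let _ : MeasurableSpace Gᵐᵒᵖ := borel Gᵐᵒᵖ
    have : BorelSpace Gᵐᵒᵖ := ⟨rfl⟩
    have : Fact ((2 : ℝ≥0∞) ≠ ∞) := ⟨by norm_num⟩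
    have h : Continuous fun g : G => DomMulAct.mk (MulOpposite.op g) :=
      DomMulAct.continuous_mk.comp MulOpposite.continuous_op
    exact h.smul continuous_const

/-- The representation above is indeed given by right translations. -/
theorem rightTranslationRep_ae_eq (μ : Measure X) [μ.Regular] [IsLocallyFiniteMeasure μ]
    [SMulInvariantMeasure Gᵐᵒᵖ X μ] (g : G) (f : Lp ℂ 2 μ) :
    ((rightTranslationRep μ).toHom g f : X → ℂ) =ᵐ[μ] fun x => f (MulOpposite.op g • x) :=
  DomMulAct.smul_Lp_ae_eq _ f

end RightTranslation

/-! ### The space `H \ G` of right cosets -/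

/-- The space `H \ G` of right cosets `H g`. -/
def RightCosets {G : Type*} [Group G] (H : Subgroup G) : Type _ :=
  Quotient (QuotientGroup.rightRel H)

namespace RightCosets

variable {G : Type*} [Group G] {H : Subgroup G}

/-- The projection `g ↦ H g`. -/
def mk (H : Subgroup G) (g : G) : RightCosets H := Quotient.mk (QuotientGroup.rightRel H) g

theorem mk_surjective : Function.Surjective (mk H) := Quotient.mk_surjective

theorem mk_eq_mk {a b : G} : mk H a = mk H b ↔ b * a⁻¹ ∈ H := by
  rw [← QuotientGroup.rightRel_apply]
  exact Quotient.eq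

/-- The right action `(H x) g = H x g` of `G` on `H \ G`, written as an action of `Gᵐᵒᵖ`. -/
instance : MulAction Gᵐᵒᵖ (RightCosets H) where
  smul g := Quotient.map (fun x => x * g.unop) (by
    intro a b hab
    have hab' := QuotientGroup.rightRel_apply.1 hab
    refine QuotientGroup.rightRel_apply.2 ?_
    simpa [mul_assoc] using hab')
  one_smul x := by
    obtain ⟨x, rfl⟩ := mk_surjective x
    exact congrArg (mk H) (mul_one x)
  mul_smul g h x := by
    obtain ⟨x, rfl⟩ := mk_surjective x
    exact congrArg (mk H) (mul_assoc x h.unop g.unop).symm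

theorem op_smul_mk (g x : G) : MulOpposite.op g • mk H x = mk H (x * g) := rfl

variable [TopologicalSpace G]

/-- The quotient topology on `H \ G`. -/
instance : TopologicalSpace (RightCosets H) :=
  inferInstanceAs (TopologicalSpace (Quotient (QuotientGroup.rightRel H)))

/-- The Borel sigma-algebra on `H \ G`. -/
instance : MeasurableSpace (RightCosets H) := borel _

instance : BorelSpace (RightCosets H) := ⟨rfl⟩

theorem isQuotientMap_mk : IsQuotientMap (mk H) := isQuotientMap_quotient_mk'

variable [IsTopologicalGroup G]

theorem isOpenQuotientMap_mk : IsOpenQuotientMap (mk H) :=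
  MulAction.isOpenQuotientMap_quotientMk (Γ := H) (T := G)

instance : ContinuousSMul Gᵐᵒᵖ (RightCosets H) where
  continuous_smul := by
    have hq : IsOpenQuotientMap (Prod.map (id : Gᵐᵒᵖ → Gᵐᵒᵖ) (mk H)) :=
      IsOpenQuotientMap.id.prodMap isOpenQuotientMap_mk
    refine hq.isQuotientMap.continuous_iff.2 ?_
    have h : Continuous fun p : Gᵐᵒᵖ × G => p.2 * p.1.unop :=
      continuous_snd.mul (MulOpposite.continuous_unop.comp continuous_fst)
    exact isQuotientMap_mk.continuous.comp h

instance : RegularSpace (RightCosets H) := by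
  refine RegularSpace.of_exists_mem_nhds_isClosed_subset fun x U hU => ?_
  obtain ⟨x, rfl⟩ := mk_surjective x
  have hc : Tendsto (fun p : G × G => mk H (x * p.1 * p.2⁻¹)) (𝓝 (1, 1)) (𝓝 (mk H x)) := by
    have h : Continuous fun p : G × G => mk H (x * p.1 * p.2⁻¹) :=
      isQuotientMap_mk.continuous.comp (by fun_prop)
    simpa using h.tendsto (1, 1)
  have hW := hc hU
  rw [nhds_prod_eq, mem_map, mem_prod_same_iff] at hW
  obtain ⟨V, hV, hVU⟩ := hW
  refine ⟨closure (mk H '' ((fun v => x * v) '' V)), ?_, isClosed_closure, ?_⟩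
  · refine mem_of_superset (isOpenQuotientMap_mk.isOpenMap.image_mem_nhds ?_) subset_closure
    simpa using (Homeomorph.mulLeft x).isOpenMap.image_mem_nhds hV
  · intro y hy
    obtain ⟨y, rfl⟩ := mk_surjective y
    have hyV : mk H '' ((fun v => y * v) '' V) ∈ 𝓝 (mk H y) := by
      refine isOpenQuotientMap_mk.isOpenMap.image_mem_nhds ?_
      simpa using (Homeomorph.mulLeft y).isOpenMap.image_mem_nhds hV
    obtain ⟨_, ⟨_, ⟨v, hv, rfl⟩, rfl⟩, ⟨_, ⟨w, hw, rfl⟩, h⟩⟩ :=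
      mem_closure_iff_nhds.1 hy _ hyV
    have h1 : mk H y = mk H (x * w * v⁻¹) := by
      have h2 := congrArg (fun z => MulOpposite.op v⁻¹ • z) h
      simp only [op_smul_mk] at h2
      simpa using h2.symm
    rw [h1]
    exact hVU (Set.mk_mem_prod hw hv)

end RightCosets

/-! ### Unimodular and tempered subgroups -/

section Subgroups

variable {G : Type*} [Group G] [TopologicalSpace G] [IsTopologicalGroup G]
  [MeasurableSpace G] [BorelSpace G]

/-- A unitary representation of the (unimodular) group `G` is tempered if it is weakly contained
in the right regular representation on `L²(G, dg)`, where `dg` is a Haar measure on `G`; the choice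
of `dg` is immaterial. -/
def UnitaryRep.IsTempered {V : Type*} [NormedAddCommGroup V] [InnerProductSpace ℂ V]
    (π : UnitaryRep G V) : Prop :=
  ∃ (dg : Measure G) (_ : dg.IsHaarMeasure) (_ : dg.IsMulRightInvariant) (_ : dg.Regular)
    (_ : IsLocallyFiniteMeasure dg),
    π.WeaklyContainedIn (rightTranslationRep (G := G) dg)

/-- A subgroup is unimodular if it carries a Haar measure which is both left- and
right-invariant. -/
def IsUnimodularSubgroup (H : Subgroup G) : Prop :=
  ∃ ν : Measure H, ν.IsHaarMeasure ∧ ν.IsMulRightInvariant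

/-- `H` is a tempered subgroup of `G` if the quasi-regular representation of `G` on `L²(H \ G)`,
with respect to the nonzero `G`-invariant Radon measure on `H \ G` (unique up to scaling), is
tempered. -/
def IsTemperedSubgroup (H : Subgroup G) : Prop :=
  ∃ (μ : Measure (RightCosets H)) (_ : μ.Regular) (_ : IsLocallyFiniteMeasure μ)
    (_ : SMulInvariantMeasure Gᵐᵒᵖ (RightCosets H) μ),
    μ ≠ 0 ∧ (rightTranslationRep (G := G) μ).IsTempered

/-- `H` is the Chabauty limit of the sequence of subgroups `Γ n`: every element of `H` is a limit
of elements of the `Γ n`, and all limit points of sequences `g n ∈ Γ n` lie in `H`. -/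
def ChabautyTendsto (Γ : ℕ → Subgroup G) (H : Subgroup G) : Prop :=
  (∀ h ∈ H, ∃ γ : ℕ → G, (∀ n, γ n ∈ Γ n) ∧ Tendsto γ atTop (𝓝 h)) ∧
    ∀ g : ℕ → G, (∀ n, g n ∈ Γ n) → ∀ x : G, MapClusterPt x atTop g → x ∈ H

end Subgroups

/-! ### Semisimple real algebraic groups -/

section Algebraic

variable {N : ℕ}

/-- A subgroup of `GL_N(ℝ)` is Zariski closed if it is cut out in `GL_N(ℝ)` by polynomial equations
in the matrix entries. -/
def IsZariskiClosed (A : Subgroup (GL (Fin N) ℝ)) : Prop :=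
  ∃ S : Set (MvPolynomial (Fin N × Fin N) ℝ), ∀ g : GL (Fin N) ℝ,
    g ∈ A ↔ ∀ p ∈ S, MvPolynomial.eval (fun ij => (g : Matrix (Fin N) (Fin N) ℝ) ij.1 ij.2) p = 0

/-- A Zariski closed subgroup of `GL_N(ℝ)` is connected (in the Zariski topology) if it has no
proper Zariski closed subgroup of finite index. -/
def IsZariskiConnected (A : Subgroup (GL (Fin N) ℝ)) : Prop :=
  ∀ B : Subgroup (GL (Fin N) ℝ), B ≤ A → IsZariskiClosed B → B.IsFiniteRelIndex A → B = A

/-- A connected semisimple algebraic subgroup of `GL_N(ℝ)`: Zariski closed, Zariski connected, and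
with trivial radical, i.e. without nontrivial Zariski connected, Zariski closed, solvable, normal
subgroups. -/
structure IsConnectedSemisimpleAlgebraic (A : Subgroup (GL (Fin N) ℝ)) : Prop where
  isZariskiClosed : IsZariskiClosed A
  isZariskiConnected : IsZariskiConnected A
  radical_eq_bot : ∀ R : Subgroup (GL (Fin N) ℝ), R ≤ A → (R.subgroupOf A).Normal →
    IsZariskiClosed R → IsZariskiConnected R → Group.IsSolvable R → R = ⊥

end Algebraic

/-- The topological group `G` is a connected semisimple real algebraic group: it is isomorphic to
an open subgroup (in the Euclidean topology) of the group of real points of a connected semisimple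
linear algebraic group over `ℝ`. This covers the full group of real points as well as its identity
component, such as `SO(p,q)` and `SO°(p,q)`
for `p + q ≥ 3`. -/
def IsConnectedSemisimpleRealAlgebraicGroup (G : Type*) [Group G] [TopologicalSpace G] : Prop :=
  ∃ (N : ℕ) (A : Subgroup (GL (Fin N) ℝ)) (ρ : G →* A),
    IsConnectedSemisimpleAlgebraic A ∧ IsOpenEmbedding ρ

end

noncomputable section

set_option linter.unusedSectionVars false

/-! ### Topology of `G` and of `H \ G` -/

section Topology

/-! The algebraic structure enters only through the topology: `G` is Polish and locally compact. The
rest is a vague-limit argument for Haar measures of subgroups, regarded as measures on `G`.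

Rescale the counting measures of the `Γ n` to give mass one to a fixed compact neighbourhood of the
identity. They are then uniformly bounded on compact sets (`exists_forall_subgroupHaar_le`), so they
converge vaguely along a nonprincipal ultrafilter. Chabauty convergence makes the limit a nonzero
measure carried by `H`, left `H`-invariant and inversion-invariant
(`exists_isSubgroupHaar_tendsto_integral`). It is therefore a bi-invariant Haar measure of `H`, and
`H` is unimodular.

For temperedness, every compactly supported continuous function on `H \ G` is an average of some `φ`
in `C_c(G)` over the cosets (`exists_cosetIntegral_eq`). Unfolding writes its matrix coefficient at
`g` as the integral over `H` of `correlation dg φ g`, a compactly supported continuous function that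
does not involve `H` (`integral_conj_cosetIntegral_mul`). The same `φ`, averaged over `Γ n`, gives a
vector of `L²(Γ n \ G)` whose coefficient is the integral of the same function against the measure
of `Γ n`. Vague convergence makes these coefficients close, uniformly for `g` in a compact set
(`eventually_forall_norm_integral_sub_lt`), and temperedness of one suitable `Γ n` supplies the
approximant from the regular representation. Density of `C_c` in `L²` handles general vectors. -/

theorem IsZariskiClosed.isClosed {N : ℕ} {A : Subgroup (GL (Fin N) ℝ)} (hA : IsZariskiClosed A) :
    IsClosed (A : Set (GL (Fin N) ℝ)) := by
  obtain ⟨S, hS⟩ := hA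
  have h : (A : Set (GL (Fin N) ℝ)) = ⋂ p ∈ S, {g : GL (Fin N) ℝ | MvPolynomial.eval
      (fun ij => (g : Matrix (Fin N) (Fin N) ℝ) ij.1 ij.2) p = 0} := by
    ext g
    simpa using hS g
  rw [h]
  refine isClosed_biInter fun p _ => isClosed_eq ?_ continuous_const
  refine (MvPolynomial.continuous_eval p).comp (continuous_pi fun ij => ?_)
  exact Units.continuous_val.matrix_elem ij.1 ij.2

instance Matrix.instPolishSpace {m n : Type*} [Countable m] [Countable n] :
    PolishSpace (Matrix m n ℝ) :=
  inferInstanceAs (PolishSpace (m → n → ℝ))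

instance Units.instPolishSpace {M : Type*} [Monoid M] [TopologicalSpace M] [ContinuousMul M]
    [PolishSpace M] : PolishSpace Mˣ := by
  have : PolishSpace Mᵐᵒᵖ := MulOpposite.opHomeomorph.symm.isClosedEmbedding.polishSpace
  exact Units.isClosedEmbedding_embedProduct.polishSpace

instance Matrix.instLocallyCompactSpace {m n : Type*} [Finite m] [Finite n] :
    LocallyCompactSpace (Matrix m n ℝ) :=
  inferInstanceAs (LocallyCompactSpace (m → n → ℝ))

theorem IsConnectedSemisimpleRealAlgebraicGroup.polishSpace_and_locallyCompactSpace
    {G : Type*} [Group G] [TopologicalSpace G] (hG : IsConnectedSemisimpleRealAlgebraicGroup G) :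
    PolishSpace G ∧ LocallyCompactSpace G := by
  obtain ⟨N, A, ρ, hA, hρ⟩ := hG
  have hAc := hA.isZariskiClosed.isClosed
  have : PolishSpace A := hAc.polishSpace
  have : LocallyCompactSpace A := hAc.isClosedEmbedding_subtypeVal.locallyCompactSpace
  have : PolishSpace (Set.range ρ) := hρ.isOpen_range.polishSpace
  exact ⟨hρ.toIsEmbedding.toHomeomorph.isClosedEmbedding.polishSpace,
    hρ.locallyCompactSpace⟩

namespace RightCosets

variable {G : Type*} [Group G] [TopologicalSpace G] [IsTopologicalGroup G] {H : Subgroup G}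

theorem continuous_mk : Continuous (mk H) := isQuotientMap_mk.continuous

theorem t2Space (hH : IsClosed (H : Set G)) : T2Space (RightCosets H) := by
  have : T1Space (RightCosets H) := by
    refine ⟨fun x => ?_⟩
    obtain ⟨x, rfl⟩ := mk_surjective x
    rw [← isQuotientMap_mk.isClosed_preimage]
    have : mk H ⁻¹' {mk H x} = (fun y => x * y⁻¹) ⁻¹' H := by
      ext y
      simp [mk_eq_mk]
    rw [this]
    exact hH.preimage (by fun_prop)
  infer_instance

instance [SecondCountableTopology G] : SecondCountableTopology (RightCosets H) :=
  isQuotientMap_mk.secondCountableTopology isOpenQuotientMap_mk.isOpenMap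

instance [LocallyCompactSpace G] : LocallyCompactSpace (RightCosets H) :=
  isOpenQuotientMap_mk.locallyCompactSpace

/-- A compact subset of `H \ G` is covered by the image of a compact subset of `G`. -/
theorem exists_isCompact_subset_image_mk [LocallyCompactSpace G] {K : Set (RightCosets H)}
    (hK : IsCompact K) : ∃ C : Set G, IsCompact C ∧ K ⊆ mk H '' C := by
  have hsec : ∀ q : RightCosets H, ∃ C : Set G, IsCompact C ∧ mk H '' C ∈ 𝓝 q := by
    intro q
    obtain ⟨x, rfl⟩ := mk_surjective q
    obtain ⟨C, hC, hx⟩ := exists_compact_mem_nhds x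
    exact ⟨C, hC, isOpenQuotientMap_mk.isOpenMap.image_mem_nhds hx⟩
  choose C hC hCn using hsec
  obtain ⟨t, -, ht⟩ := hK.elim_nhds_subcover (fun q => mk H '' C q) fun q _ => hCn q
  refine ⟨⋃ q ∈ t, C q, t.isCompact_biUnion fun q _ => hC q, ht.trans ?_⟩
  simp only [Set.image_iUnion]
  exact subset_rfl

theorem measurable_mk [MeasurableSpace G] [BorelSpace G] : Measurable (mk H) :=
  continuous_mk.measurable

/-- A function on `H \ G` is Borel as soon as its lift to `G` is. -/
theorem measurable_comp_mk_iff [PolishSpace G] [MeasurableSpace G] [BorelSpace G]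
    (hH : IsClosed (H : Set G)) {Y : Type*} [MeasurableSpace Y] {f : RightCosets H → Y} :
    Measurable (f ∘ mk H) ↔ Measurable f := by
  have := t2Space hH
  -- This rests on the descriptive set theory of Borel surjections from a standard Borel space; no
  -- Borel section is needed.
  exact measurable_mk.measurable_comp_iff_of_surjective mk_surjective

end RightCosets

end Topology

/-! ### Haar measures of unimodular subgroups, and the quotient measure -/

section SubgroupHaar

open Pointwise

variable {G : Type*} [Group G] [TopologicalSpace G] [MeasurableSpace G]

/-- The measure `m` on `G` is the extension by zero of a Haar measure of the unimodular closed
subgroup `H`. -/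
structure IsSubgroupHaar (H : Subgroup G) (m : Measure G) : Prop where
  isFiniteMeasureOnCompacts : IsFiniteMeasureOnCompacts m
  ne_zero : m ≠ 0
  compl_eq_zero : m (H : Set G)ᶜ = 0
  map_mul_left : ∀ h ∈ H, m.map (fun k => h * k) = m
  map_inv : m.map (fun k => k⁻¹) = m

variable [IsTopologicalGroup G] [BorelSpace G] {H : Subgroup G} {m : Measure G}

namespace IsSubgroupHaar

/-- Inversion conjugates right translation by `h` into left translation by `h⁻¹`, and both preserve
`m`. -/
theorem map_mul_right (hm : IsSubgroupHaar H m) {h : G} (hh : h ∈ H) :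
    m.map (fun k => k * h) = m := by
  have hl : Measurable fun k : G => h⁻¹ * k := (continuous_const_mul _).measurable
  have hi : Measurable fun k : G => k⁻¹ := continuous_inv.measurable
  have hr : Measurable fun k : G => k * h := (continuous_mul_const _).measurable
  calc m.map (fun k => k * h) = ((m.map fun k => k⁻¹).map fun k => h⁻¹ * k).map fun k => k⁻¹ := by
        rw [Measure.map_map hl hi, Measure.map_map hi (hl.comp hi)]
        congr 1
        ext k
        simp
    _ = m := by rw [hm.map_inv, hm.map_mul_left _ (H.inv_mem hh), hm.map_inv]

theorem lintegral_mul_right (hm : IsSubgroupHaar H m) {h : G} (hh : h ∈ H) {f : G → ℝ≥0∞}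
    (hf : Measurable f) : ∫⁻ k, f (k * h) ∂m = ∫⁻ k, f k ∂m := by
  have hr : Measurable fun k : G => k * h := (continuous_mul_const _).measurable
  conv_rhs => rw [← hm.map_mul_right hh, lintegral_map hf hr]

theorem lintegral_inv (hm : IsSubgroupHaar H m) {f : G → ℝ≥0∞}
    (hf : Measurable f) : ∫⁻ k, f k⁻¹ ∂m = ∫⁻ k, f k ∂m := by
  have hi : Measurable fun k : G => k⁻¹ := continuous_inv.measurable
  conv_rhs => rw [← hm.map_inv, lintegral_map hf hi]

theorem ae_mem (hm : IsSubgroupHaar H m) : ∀ᵐ k ∂m, k ∈ H := by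
  rw [ae_iff]
  exact hm.compl_eq_zero

theorem integral_mul_right (hm : IsSubgroupHaar H m) {h : G} (hh : h ∈ H) (f : G → ℂ) :
    ∫ k, f (k * h) ∂m = ∫ k, f k ∂m := by
  conv_rhs => rw [← hm.map_mul_right hh]
  exact ((Homeomorph.mulRight h).measurableEmbedding.integral_map f).symm

/-- The integral over `H x` depends only on the coset `H x`. -/
theorem lintegral_mul_eq_of_mk_eq (hm : IsSubgroupHaar H m) {f : G → ℝ≥0∞} (hf : Measurable f)
    {x y : G} (hxy : RightCosets.mk H x = RightCosets.mk H y) :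
    ∫⁻ k, f (k * x) ∂m = ∫⁻ k, f (k * y) ∂m := by
  have := hm.lintegral_mul_right (RightCosets.mk_eq_mk.1 hxy)
    (f := fun k => f (k * x)) (hf.comp (continuous_mul_const _).measurable)
  rw [← this]
  simp [mul_assoc]

theorem integral_mul_eq_of_mk_eq (hm : IsSubgroupHaar H m) (f : G → ℂ)
    {x y : G} (hxy : RightCosets.mk H x = RightCosets.mk H y) :
    ∫ k, f (k * x) ∂m = ∫ k, f (k * y) ∂m := by
  rw [← hm.integral_mul_right (RightCosets.mk_eq_mk.1 hxy) (f := fun k => f (k * x))]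
  simp [mul_assoc]

/-- The mass of `{k ∈ H | k x ∈ K}` is bounded independently of `x`. -/
theorem measure_mul_mem_le (hm : IsSubgroupHaar H m) (K : Set G) (hK : IsCompact K) [T2Space G]
    (x : G) : m {k | k * x ∈ K} ≤ m (K * K⁻¹) := by
  by_cases h : ∃ h ∈ H, h * x ∈ K
  · obtain ⟨h, hh, hx⟩ := h
    have hr : Measurable fun k : G => k * h⁻¹ := (continuous_mul_const _).measurable
    have hKK : MeasurableSet (K * K⁻¹) := (hK.mul hK.inv).measurableSet
    conv_rhs => rw [← hm.map_mul_right (H.inv_mem hh), Measure.map_apply hr hKK]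
    -- Here `k * h⁻¹ = (k * x) * (h * x)⁻¹`, a product in `K * K⁻¹`.
    refine measure_mono fun k hk => ⟨k * x, hk, (h * x)⁻¹, Set.inv_mem_inv.2 hx, ?_⟩
    simp [mul_assoc]
  · push Not at h
    refine (measure_mono (t := (H : Set G)ᶜ) fun k hk hkH => h k hkH hk).trans ?_
    rw [hm.compl_eq_zero]
    exact zero_le

variable [PolishSpace G] [LocallyCompactSpace G]

theorem sigmaFinite (hm : IsSubgroupHaar H m) : SigmaFinite m := by
  have := hm.isFiniteMeasureOnCompacts
  infer_instance

/-- Suppose `V` is null and take `W` with `W⁻¹ * W ⊆ V`. A translate `x W` either misses `H` or lies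
in some `h V` with `h ∈ H`. It is null in both cases, so `m` is locally null, hence zero. -/
theorem measure_pos_of_mem_nhds_one (hm : IsSubgroupHaar H m) {V : Set G} (hV : V ∈ 𝓝 (1 : G)) :
    0 < m V := by
  by_contra h0
  refine hm.ne_zero ?_
  have h0 : m V = 0 := by simpa using h0
  obtain ⟨W, hW, hWo, hWV⟩ : ∃ W ∈ 𝓝 (1 : G), IsOpen W ∧ ∀ v ∈ W, ∀ w ∈ W, v⁻¹ * w ∈ V := by
    have hc : Tendsto (fun p : G × G => p.1⁻¹ * p.2) (𝓝 (1, 1)) (𝓝 1) := by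
      have h : Continuous fun p : G × G => p.1⁻¹ * p.2 := by fun_prop
      simpa using h.tendsto (1, 1)
    have hW := hc hV
    rw [nhds_prod_eq, mem_map, mem_prod_same_iff] at hW
    obtain ⟨W, hW, hWV⟩ := hW
    obtain ⟨U, hUW, hUo, h1⟩ := mem_nhds_iff.1 hW
    exact ⟨U, hUo.mem_nhds h1, hUo, fun v hv w hw => hWV (Set.mk_mem_prod (hUW hv) (hUW hw))⟩
  have hnull : ∀ x : G, m ((fun k => x⁻¹ * k) ⁻¹' W) = 0 := by
    intro x
    by_cases h : ∃ h ∈ H, x⁻¹ * h ∈ W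
    · obtain ⟨h, hh, hx⟩ := h
      obtain ⟨V', hV'V, hV'o, h1⟩ := mem_nhds_iff.1 hV
      refine measure_mono_null (t := (fun k => h⁻¹ * k) ⁻¹' toMeasurable m V) ?_ ?_
      · intro k hk
        refine subset_toMeasurable _ _ ?_
        simpa [mul_assoc] using hWV _ hx _ hk
      · rw [← Measure.map_apply (continuous_const_mul _).measurable (measurableSet_toMeasurable _ _),
          hm.map_mul_left _ (H.inv_mem hh), measure_toMeasurable, h0]
    · push Not at h
      exact measure_mono_null (fun k hk hkH => h k hkH hk) hm.compl_eq_zero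
  refine Measure.measure_univ_eq_zero.1 ?_
  refine measure_null_of_locally_null _ fun x _ => ?_
  refine ⟨_, mem_nhdsWithin_of_mem_nhds ?_, hnull x⟩
  refine (continuous_const_mul x⁻¹).continuousAt.preimage_mem_nhds ?_
  simpa using hW

/-- There is a Borel function of total mass one along every coset of `H`. -/
theorem exists_weight (hm : IsSubgroupHaar H m) :
    ∃ β : G → ℝ≥0∞, Measurable β ∧ ∀ x, ∫⁻ k, β (k * x) ∂m = 1 := by
  have := hm.isFiniteMeasureOnCompacts
  let K := compactCovering G
  have hK : ∀ n, IsCompact (K n) := isCompact_compactCovering G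
  let c : ℕ → ℝ≥0∞ := fun n => m (K n * (K n)⁻¹) + 1
  have hc : ∀ n, c n ≠ ∞ := fun n =>
    ENNReal.add_ne_top.2 ⟨((hK n).mul (hK n).inv).measure_lt_top.ne, ENNReal.one_ne_top⟩
  -- The `δ n` are positive, so `w` vanishes nowhere. They are small against the bounds on the mass
  -- in `K n` along a coset, so the coset integral `W` of `w` is finite.
  obtain ⟨δ, hδ, hδs⟩ := ENNReal.exists_pos_tsum_mul_lt_of_countable one_ne_zero c hc
  let w : G → ℝ≥0∞ := fun x => ∑' n, (K n).indicator (fun _ => (δ n : ℝ≥0∞)) x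
  have hw : Measurable w :=
    Measurable.tsum fun n => measurable_const.indicator (hK n).measurableSet
  have hwpos : ∀ x, w x ≠ 0 := by
    intro x hx
    obtain ⟨n, hn⟩ := exists_mem_compactCovering x
    have := ENNReal.tsum_eq_zero.1 hx n
    rw [Set.indicator_of_mem hn] at this
    simpa using (hδ n).ne' (by simpa using this)
  let W : G → ℝ≥0∞ := fun x => ∫⁻ k, w (k * x) ∂m
  have hsf := hm.sigmaFinite
  have hWm : Measurable W := by
    have : Measurable fun p : G × G => w (p.2 * p.1) := hw.comp (by fun_prop)
    exact this.lintegral_prod_right'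
  have hWpos : ∀ x, W x ≠ 0 := by
    intro x hx
    have h1 : Measurable fun k => w (k * x) := hw.comp (continuous_mul_const _).measurable
    have h2 := (lintegral_eq_zero_iff h1).1 hx
    refine hm.ne_zero (Measure.measure_univ_eq_zero.1 ?_)
    have h3 := ae_iff.1 h2
    simpa [hwpos] using h3
  have hWtop : ∀ x, W x ≠ ∞ := by
    intro x
    refine ne_top_of_le_ne_top ENNReal.one_ne_top (le_trans ?_ hδs.le)
    have hms : ∀ n, MeasurableSet {k : G | k * x ∈ K n} := fun n =>
      (continuous_mul_const x).measurable (hK n).measurableSet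
    calc W x = ∑' n, ∫⁻ k, {k : G | k * x ∈ K n}.indicator (fun _ => (δ n : ℝ≥0∞)) k ∂m := by
          rw [← lintegral_tsum fun n => (measurable_const.indicator (hms n)).aemeasurable]
          rfl
      _ ≤ _ := ENNReal.tsum_le_tsum fun n => by
          rw [lintegral_indicator (hms n), setLIntegral_const, mul_comm]
          gcongr
          exact (hm.measure_mul_mem_le (K n) (hK n) x).trans le_self_add
  -- `W` is constant along cosets, so dividing by it normalizes each coset integral to one.
  refine ⟨fun x => w x / W x, hw.div hWm, fun x => ?_⟩
  have hWk : ∀ᵐ k ∂m, w (k * x) / W (k * x) = w (k * x) / W x := by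
    filter_upwards [hm.ae_mem] with k hk
    congr 1
    refine hm.lintegral_mul_eq_of_mk_eq hw (RightCosets.mk_eq_mk.2 ?_)
    simpa using H.inv_mem hk
  rw [lintegral_congr_ae hWk]
  simp_rw [div_eq_mul_inv]
  rw [lintegral_mul_const _ (show Measurable fun k => w (k * x) from
    hw.comp (continuous_mul_const _).measurable)]
  exact ENNReal.mul_inv_cancel (hWpos x) (hWtop x)

end IsSubgroupHaar

end SubgroupHaar

/-! ### The invariant measure on `H \ G`: unfolding, existence and uniqueness. -/

section QuotientMeasure

open Pointwise

variable {G : Type*} [Group G] [TopologicalSpace G] [MeasurableSpace G]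

/-- The image in `H \ G` of the measure with density `β` with respect to `dg`. For a function `β`
of total mass one along the cosets of `H`, this is the invariant measure on `H \ G`. -/
def quotientMeasure (H : Subgroup G) (β : G → ℝ≥0∞) (dg : Measure G) : Measure (RightCosets H) :=
  (dg.withDensity β).map (RightCosets.mk H)

/-- The function `β` on `G` is Borel and of total mass one along the cosets of `H`. -/
structure IsCosetWeight (m : Measure G) (β : G → ℝ≥0∞) : Prop where
  measurable : Measurable β
  lintegral_eq_one : ∀ x, ∫⁻ k, β (k * x) ∂m = 1

variable [IsTopologicalGroup G] [BorelSpace G] [PolishSpace G] [LocallyCompactSpace G]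
  {H : Subgroup G} {m : Measure G} {β : G → ℝ≥0∞}
  {dg : Measure G} [dg.IsHaarMeasure]

theorem lintegral_quotientMeasure (hβ : Measurable β) {F : RightCosets H → ℝ≥0∞}
    (hF : Measurable F) :
    ∫⁻ q, F q ∂(quotientMeasure H β dg) = ∫⁻ x, β x * F (RightCosets.mk H x) ∂dg := by
  rw [quotientMeasure, lintegral_map hF RightCosets.measurable_mk,
    lintegral_withDensity_eq_lintegral_mul _ hβ (show Measurable fun x => F (RightCosets.mk H x) from
      hF.comp RightCosets.measurable_mk)]
  rfl

namespace IsSubgroupHaar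

/-- The basic unfolding identity. Tonelli and left invariance of `dg` move the translation by `k`
from `ψ` onto `β`; inversion invariance of `m` then makes the coset integral of `β` appear, which is
one. -/
theorem lintegral_weight_mul (hm : IsSubgroupHaar H m) (hβ : IsCosetWeight m β)
    {ψ : G → ℝ≥0∞} (hψ : Measurable ψ) :
    ∫⁻ x, β x * ∫⁻ k, ψ (k * x) ∂m ∂dg = ∫⁻ x, ψ x ∂dg := by
  have := hm.sigmaFinite
  have hψ' : Measurable fun p : G × G => ψ (p.2 * p.1) := hψ.comp (by fun_prop)
  have hβi : Measurable fun p : G × G => β (p.2⁻¹ * p.1) := hβ.measurable.comp (by fun_prop)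
  calc ∫⁻ x, β x * ∫⁻ k, ψ (k * x) ∂m ∂dg
      = ∫⁻ x, ∫⁻ k, β x * ψ (k * x) ∂m ∂dg := by
        refine lintegral_congr fun x => ?_
        rw [lintegral_const_mul _ (show Measurable fun k => ψ (k * x) from
          hψ'.comp measurable_prodMk_left)]
    _ = ∫⁻ k, ∫⁻ x, β x * ψ (k * x) ∂dg ∂m :=
        lintegral_lintegral_swap ((hβ.measurable.comp measurable_fst).mul hψ').aemeasurable
    _ = ∫⁻ k, ∫⁻ x, β (k⁻¹ * x) * ψ x ∂dg ∂m := by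
        refine lintegral_congr fun k => ?_
        rw [← lintegral_mul_left_eq_self (fun x => β (k⁻¹ * x) * ψ x) k]
        simp
    _ = ∫⁻ x, ∫⁻ k, β (k⁻¹ * x) * ψ x ∂m ∂dg :=
        (lintegral_lintegral_swap (hβi.mul (hψ.comp measurable_fst)).aemeasurable).symm
    _ = ∫⁻ x, ψ x ∂dg := by
        refine lintegral_congr fun x => ?_
        rw [lintegral_mul_const _ (show Measurable fun k => β (k⁻¹ * x) from
          hβi.comp measurable_prodMk_left),
          hm.lintegral_inv (f := fun k => β (k * x))
            (hβ.measurable.comp (continuous_mul_const _).measurable), hβ.lintegral_eq_one, one_mul]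

/-- Unfolding in a form that also transfers integrability, as complex-valued integrands require. -/
theorem measurePreserving_mul (hm : IsSubgroupHaar H m) (hβ : IsCosetWeight m β) :
    MeasurePreserving (fun p : G × G => p.2 * p.1) ((dg.withDensity β).prod m) dg := by
  have := hm.sigmaFinite
  have hmul : Measurable fun p : G × G => p.2 * p.1 := by fun_prop
  refine ⟨hmul, Measure.ext_of_lintegral _ fun ψ hψ => ?_⟩
  have hψm : Measurable fun p : G × G => ψ (p.2 * p.1) := hψ.comp hmul
  rw [lintegral_map hψ hmul, lintegral_prod _ hψm.aemeasurable,
    lintegral_withDensity_eq_lintegral_mul _ hβ.measurable hψm.lintegral_prod_right',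
    ← hm.lintegral_weight_mul hβ hψ]
  rfl

theorem lintegral_mul_comp_mk (hm : IsSubgroupHaar H m) (hβ : IsCosetWeight m β)
    {F : RightCosets H → ℝ≥0∞} (x : G) :
    ∫⁻ k, β (k * x) * F (RightCosets.mk H (k * x)) ∂m = F (RightCosets.mk H x) := by
  have h : ∀ᵐ k ∂m, β (k * x) * F (RightCosets.mk H (k * x))
      = β (k * x) * F (RightCosets.mk H x) := by
    filter_upwards [hm.ae_mem] with k hk
    congr 2
    exact RightCosets.mk_eq_mk.2 (by simpa using H.inv_mem hk)
  rw [lintegral_congr_ae h, lintegral_mul_const _ (show Measurable fun k => β (k * x) from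
    hβ.measurable.comp (continuous_mul_const _).measurable), hβ.lintegral_eq_one, one_mul]

theorem lintegral_quotientMeasure_eq (hm : IsSubgroupHaar H m) (hβ : IsCosetWeight m β)
    {F : RightCosets H → ℝ≥0∞} (hF : Measurable F) {ψ : G → ℝ≥0∞} (hψ : Measurable ψ)
    (h : ∀ x, F (RightCosets.mk H x) = ∫⁻ k, ψ (k * x) ∂m) :
    ∫⁻ q, F q ∂(quotientMeasure H β dg) = ∫⁻ x, ψ x ∂dg := by
  rw [lintegral_quotientMeasure hβ.measurable hF, ← hm.lintegral_weight_mul hβ hψ]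
  simp_rw [h]

/-- The invariant measure does not depend on the weight. -/
theorem quotientMeasure_congr (hm : IsSubgroupHaar H m) (hβ : IsCosetWeight m β)
    {β' : G → ℝ≥0∞} (hβ' : IsCosetWeight m β') :
    quotientMeasure H β dg = quotientMeasure H β' dg := by
  refine Measure.ext_of_lintegral _ fun F hF => ?_
  rw [lintegral_quotientMeasure hβ'.measurable hF]
  refine hm.lintegral_quotientMeasure_eq hβ hF
    (hβ'.measurable.mul (hF.comp RightCosets.measurable_mk)) fun x => ?_
  exact (hm.lintegral_mul_comp_mk hβ' x).symm

/-- A right translate of a weight is again a weight, so independence of the weight reduces the claim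
to right invariance of `dg`. -/
theorem smulInvariantMeasure_quotientMeasure [dg.IsMulRightInvariant] (hm : IsSubgroupHaar H m)
    (hβ : IsCosetWeight m β) :
    SMulInvariantMeasure Gᵐᵒᵖ (RightCosets H) (quotientMeasure H β dg) := by
  refine ⟨fun g s hs => ?_⟩
  have hsm : Measurable fun q : RightCosets H => g • q := (continuous_const_smul g).measurable
  have hβ' : IsCosetWeight m fun x => β (x * g.unop⁻¹) :=
    ⟨hβ.measurable.comp (continuous_mul_const _).measurable, fun x => by
      simpa [mul_assoc] using hβ.lintegral_eq_one (x * g.unop⁻¹)⟩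
  conv_rhs => rw [hm.quotientMeasure_congr hβ hβ']
  rw [← lintegral_indicator_one hs, ← lintegral_indicator_one (hsm hs),
    lintegral_quotientMeasure hβ.measurable (measurable_one.indicator (hsm hs)),
    lintegral_quotientMeasure hβ'.measurable (measurable_one.indicator hs),
    ← lintegral_mul_right_eq_self
      (fun x => β (x * g.unop⁻¹) * s.indicator 1 (RightCosets.mk H x)) g.unop]
  refine lintegral_congr fun x => ?_
  rw [mul_inv_cancel_right]
  rfl

theorem quotientMeasure_ne_zero (hm : IsSubgroupHaar H m) (hβ : IsCosetWeight m β) :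
    quotientMeasure H β dg ≠ 0 := by
  intro h
  have h1 := hm.lintegral_quotientMeasure_eq (dg := dg) hβ (F := fun _ => m Set.univ)
    measurable_const (ψ := fun _ => 1) measurable_const (by simp)
  rw [h] at h1
  have h2 : dg Set.univ = 0 := by simpa using h1.symm
  exact NeZero.ne dg (Measure.measure_univ_eq_zero.1 h2)

/-- If `C` projects onto a set containing `K`, the coset integral of the indicator of `V * C` is at
least `m V > 0` over `K`. Unfolding bounds `m V` times the mass of `K` by `dg (V * C)`. -/
theorem isFiniteMeasureOnCompacts_quotientMeasure (hH : IsClosed (H : Set G))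
    (hm : IsSubgroupHaar H m) (hβ : IsCosetWeight m β) :
    IsFiniteMeasureOnCompacts (quotientMeasure H β dg) := by
  have := hm.isFiniteMeasureOnCompacts
  have := hm.sigmaFinite
  have := RightCosets.t2Space hH
  refine ⟨fun K hK => ?_⟩
  obtain ⟨C, hC, hKC⟩ := RightCosets.exists_isCompact_subset_image_mk hK
  obtain ⟨V, hV, hV1⟩ := exists_compact_mem_nhds (1 : G)
  have hVpos := hm.measure_pos_of_mem_nhds_one hV1
  have hVC : MeasurableSet (V * C) := (hV.mul hC).measurableSet
  let ψ : G → ℝ≥0∞ := (V * C).indicator 1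
  have hψ : Measurable ψ := measurable_one.indicator hVC
  have hle : m V * quotientMeasure H β dg K ≤ ∫⁻ x, ψ x ∂dg := by
    rw [← hm.lintegral_weight_mul hβ hψ, ← lintegral_indicator_one hK.measurableSet,
      lintegral_quotientMeasure hβ.measurable (measurable_one.indicator hK.measurableSet),
      ← lintegral_const_mul' _ _ hV.measure_lt_top.ne]
    refine lintegral_mono fun x => ?_
    rw [mul_left_comm]
    gcongr
    by_cases hx : RightCosets.mk H x ∈ K
    · obtain ⟨c, hc, hcx⟩ := hKC hx
      rw [← hm.lintegral_mul_eq_of_mk_eq hψ hcx, Set.indicator_of_mem hx, Pi.one_apply, mul_one,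
        ← lintegral_indicator_one hV.measurableSet]
      refine lintegral_mono fun k => ?_
      by_cases hk : k ∈ V
      · simp only [ψ, Set.indicator_of_mem (Set.mul_mem_mul hk hc), Set.indicator_of_mem hk,
          Pi.one_apply, le_refl]
      · simp [hk]
    · simp [hx]
  rw [lintegral_indicator_one hVC] at hle
  by_contra htop
  rw [not_lt, top_le_iff] at htop
  rw [htop, ENNReal.mul_top hVpos.ne', top_le_iff] at hle
  exact (hV.mul hC).measure_lt_top.ne hle

/-- Uniqueness of the invariant measure on `H \ G`. -/
theorem exists_eq_smul_quotientMeasure (hH : IsClosed (H : Set G)) [dg.IsMulRightInvariant]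
    (hm : IsSubgroupHaar H m) (hβ : IsCosetWeight m β) (μ : Measure (RightCosets H))
    [IsLocallyFiniteMeasure μ] [SMulInvariantMeasure Gᵐᵒᵖ (RightCosets H) μ] (hμ : μ ≠ 0) :
    ∃ a : NNReal, a ≠ 0 ∧ μ = a • quotientMeasure H β dg := by
  have := hm.isFiniteMeasureOnCompacts
  have := hm.sigmaFinite
  have := RightCosets.t2Space hH
  have hout : ∀ x, RightCosets.mk H (Quotient.out (RightCosets.mk H x)) = RightCosets.mk H x :=
    fun x => Quotient.out_eq _
  -- the Haar measures of the cosets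
  let κ : RightCosets H → Measure G := fun q => m.map fun k => k * Quotient.out q
  have hmr : ∀ x : G, Measurable fun k : G => k * x := fun x => (continuous_mul_const x).measurable
  have hκl : ∀ {ψ : G → ℝ≥0∞}, Measurable ψ → ∀ x,
      ∫⁻ y, ψ y ∂(κ (RightCosets.mk H x)) = ∫⁻ k, ψ (k * x) ∂m := by
    intro ψ hψ x
    rw [lintegral_map hψ (hmr _)]
    exact hm.lintegral_mul_eq_of_mk_eq hψ (hout x)
  have hκ : Measurable κ := by
    refine Measure.measurable_of_measurable_coe _ fun s hs => ?_
    -- `Quotient.out` need not be Borel, so measurability is tested on `G`, where right invariance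
    -- of `m` eliminates the section.
    rw [← RightCosets.measurable_comp_mk_iff hH]
    have h1 : ((fun q => κ q s) ∘ RightCosets.mk H)
        = fun x => ∫⁻ k, s.indicator (1 : G → ℝ≥0∞) (k * x) ∂m := by
      ext x
      rw [← hκl (measurable_one.indicator hs), lintegral_indicator_one hs]
      rfl
    rw [h1]
    have h2 : Measurable fun p : G × G => s.indicator (1 : G → ℝ≥0∞) (p.2 * p.1) :=
      (measurable_one.indicator hs).comp (by fun_prop)
    exact h2.lintegral_prod_right'
  -- `M` lifts `μ` to `G`. It is right-invariant and finite on compact sets, hence a multiple of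
  -- `dg`, and `μ` is recovered by integrating `β * (F ∘ mk)` against it.
  let M : Measure G := μ.bind κ
  have hM : ∀ {ψ : G → ℝ≥0∞}, Measurable ψ → ∫⁻ y, ψ y ∂M = ∫⁻ q, ∫⁻ y, ψ y ∂(κ q) ∂μ :=
    fun hψ => Measure.lintegral_bind hκ.aemeasurable hψ.aemeasurable
  have hMr : M.IsMulRightInvariant := by
    refine ⟨fun g => Measure.ext_of_lintegral _ fun ψ hψ => ?_⟩
    have hψg : Measurable fun y => ψ (y * g) := hψ.comp (hmr g)
    rw [lintegral_map hψ (hmr g), hM hψg, hM hψ]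
    have hmp := measurePreserving_smul (MulOpposite.op g) μ
    have hmeas : Measurable fun q => ∫⁻ y, ψ y ∂(κ q) := (Measure.measurable_lintegral hψ).comp hκ
    rw [← hmp.lintegral_comp hmeas]
    refine lintegral_congr fun q => ?_
    obtain ⟨x, rfl⟩ := RightCosets.mk_surjective q
    rw [RightCosets.op_smul_mk, hκl hψ, hκl hψg]
    simp [mul_assoc]
  have hMf : IsFiniteMeasureOnCompacts M := by
    refine ⟨fun K hK => ?_⟩
    have hind : Measurable (K.indicator (1 : G → ℝ≥0∞)) := measurable_one.indicator hK.measurableSet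
    have hmkK : IsCompact (RightCosets.mk H '' K) := hK.image RightCosets.continuous_mk
    rw [← lintegral_indicator_one hK.measurableSet, hM hind]
    calc ∫⁻ q, ∫⁻ y, K.indicator (1 : G → ℝ≥0∞) y ∂(κ q) ∂μ
        ≤ ∫⁻ q, (RightCosets.mk H '' K).indicator (fun _ => m (K * K⁻¹)) q ∂μ := by
          refine lintegral_mono fun q => ?_
          obtain ⟨x, rfl⟩ := RightCosets.mk_surjective q
          have hKx : MeasurableSet {k | k * x ∈ K} := hmr x hK.measurableSet
          have h1 : ∫⁻ y, K.indicator (1 : G → ℝ≥0∞) y ∂(κ (RightCosets.mk H x))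
              = m {k | k * x ∈ K} := by
            rw [hκl hind, ← lintegral_indicator_one hKx]
            rfl
          rw [h1]
          by_cases hx : RightCosets.mk H x ∈ RightCosets.mk H '' K
          · rw [Set.indicator_of_mem hx]
            exact hm.measure_mul_mem_le K hK x
          · rw [Set.indicator_of_notMem hx, nonpos_iff_eq_zero]
            refine measure_mono_null (t := (H : Set G)ᶜ)
              (fun k hk hkH => hx ⟨k * x, hk, ?_⟩) hm.compl_eq_zero
            exact RightCosets.mk_eq_mk.2 (by simpa using H.inv_mem hkH)
      _ = m (K * K⁻¹) * μ (RightCosets.mk H '' K) := lintegral_indicator_const hmkK.measurableSet _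
      _ < ∞ := ENNReal.mul_lt_top (hK.mul hK.inv).measure_lt_top hmkK.measure_lt_top
  obtain ⟨c, hc⟩ : ∃ c : NNReal, M = c • dg := by
    -- Uniqueness is applied to left-invariant measures, so `M` and `dg` are first inverted.
    obtain ⟨a, ha⟩ : ∃ a : NNReal, M.inv = a • dg := ⟨_, Measure.isMulLeftInvariant_eq_smul _ _⟩
    obtain ⟨b, hb⟩ : ∃ b : NNReal, dg.inv = b • dg := ⟨_, Measure.isMulLeftInvariant_eq_smul _ _⟩
    refine ⟨a * b, ?_⟩
    rw [mul_smul, ← hb, ← M.inv_inv, ha]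
    exact Measure.map_smul a dg _
  have hμc : μ = c • quotientMeasure H β dg := by
    refine Measure.ext_of_lintegral _ fun F hF => ?_
    have hβF : Measurable fun x => β x * F (RightCosets.mk H x) :=
      hβ.measurable.mul (hF.comp RightCosets.measurable_mk)
    rw [lintegral_smul_measure, lintegral_quotientMeasure hβ.measurable hF,
      ← lintegral_smul_measure, ← hc, hM hβF]
    refine lintegral_congr fun q => ?_
    obtain ⟨x, rfl⟩ := RightCosets.mk_surjective q
    rw [hκl hβF, hm.lintegral_mul_comp_mk hβ x]
  refine ⟨c, ?_, hμc⟩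
  rintro rfl
  exact hμ (by simpa using hμc)

end IsSubgroupHaar

end QuotientMeasure

/-! ### Coset averages of compactly supported functions and their matrix coefficients. -/

section CosetIntegral

open Pointwise ComplexConjugate

variable {G : Type*} [Group G] [TopologicalSpace G] [MeasurableSpace G]

/-- The function `H x ↦ ∫_H φ(h x) dm(h)` on `H \ G`. -/
def cosetIntegral (H : Subgroup G) (m : Measure G) (φ : G → ℂ) (q : RightCosets H) : ℂ :=
  ∫ k, φ (k * Quotient.out q) ∂m

/-- The function `k ↦ ∫_G conj (φ x) φ(k x g) dg(x)`. -/
def correlation (dg : Measure G) (φ : G → ℂ) (g k : G) : ℂ :=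
  ∫ x, conj (φ x) * φ (k * x * g) ∂dg

variable [IsTopologicalGroup G]

theorem HasCompactSupport.comp_mul_right {E : Type*} [Zero E] {φ : G → E}
    (hφ : HasCompactSupport φ) (x : G) : HasCompactSupport fun k => φ (k * x) :=
  hφ.comp_homeomorph (Homeomorph.mulRight x)

/-- A translate `k ↦ φ(k x)` with `x ∈ C` is supported in `supp φ * C⁻¹`. -/
theorem apply_mul_eq_zero_of_notMem {E : Type*} [Zero E] {φ : G → E} {C : Set G} {k x : G}
    (hx : x ∈ C) (hk : k ∉ tsupport φ * C⁻¹) : φ (k * x) = 0 := by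
  by_contra h
  exact hk ⟨k * x, subset_tsupport _ h, x⁻¹, Set.inv_mem_inv.2 hx, by simp⟩

variable [BorelSpace G] [PolishSpace G] [LocallyCompactSpace G]
  {H : Subgroup G} {m : Measure G} {β : G → ℝ≥0∞}
  {dg : Measure G} [dg.IsHaarMeasure]

theorem continuous_integral_comp_mul_right [IsFiniteMeasureOnCompacts m]
    {E : Type*} [NormedAddCommGroup E] [NormedSpace ℝ E] {φ : G → E}
    (hφ : Continuous φ) (hφc : HasCompactSupport φ) : Continuous fun x => ∫ k, φ (k * x) ∂m := by
  rw [continuous_iff_continuousAt]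
  intro x₀
  obtain ⟨C, hC, hx⟩ := exists_compact_mem_nhds x₀
  have h : ContinuousOn (fun x => ∫ k, φ (k * x) ∂m) C := by
    refine continuousOn_integral_of_compact_support (k := tsupport φ * C⁻¹)
      (hφc.isCompact.mul hC.inv) ?_ fun x k hxC hk => apply_mul_eq_zero_of_notMem hxC hk
    exact Continuous.continuousOn (hφ.comp (continuous_snd.mul continuous_fst))
  exact h.continuousAt hx

theorem hasCompactSupport_mul_comp_mul_mul {φ : G → ℂ} (hφc : HasCompactSupport φ) (g : G) :
    HasCompactSupport fun p : G × G => conj (φ p.1) * φ (p.2 * p.1 * g) := by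
  refine HasCompactSupport.of_support_subset_isCompact
    (K := tsupport φ ×ˢ (tsupport φ * (tsupport φ * {g})⁻¹))
    (hφc.isCompact.prod (hφc.isCompact.mul (hφc.isCompact.mul isCompact_singleton).inv)) ?_
  rintro ⟨x, k⟩ h
  rw [Function.mem_support] at h
  have hx : x ∈ tsupport φ := subset_tsupport _ fun h0 => h (by simp [h0])
  refine ⟨hx, ?_⟩
  by_contra hk
  refine h ?_
  have h1 : φ (k * (x * g)) = 0 :=
    apply_mul_eq_zero_of_notMem (Set.mul_mem_mul hx (Set.mem_singleton g)) hk
  simp only [mul_assoc, h1, mul_zero]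

/-- Fubini for a compactly supported continuous integrand. Afterwards the subgroup enters only
through the outer measure `m`. -/
theorem integral_mul_integral_eq [IsFiniteMeasureOnCompacts m] {φ : G → ℂ} (hφ : Continuous φ)
    (hφc : HasCompactSupport φ) (g : G) :
    ∫ x, conj (φ x) * ∫ k, φ (k * x * g) ∂m ∂dg = ∫ k, correlation dg φ g k ∂m := by
  simp_rw [← integral_const_mul]
  refine integral_integral_swap_of_hasCompactSupport (f := fun x k => conj (φ x) * φ (k * x * g))
    ?_ (hasCompactSupport_mul_comp_mul_mul hφc g)
  simp only [Function.uncurry_def]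
  fun_prop

namespace IsSubgroupHaar

theorem cosetIntegral_mk (hm : IsSubgroupHaar H m) (φ : G → ℂ) (x : G) :
    cosetIntegral H m φ (RightCosets.mk H x) = ∫ k, φ (k * x) ∂m :=
  hm.integral_mul_eq_of_mk_eq φ (Quotient.out_eq _)

theorem continuous_cosetIntegral (hm : IsSubgroupHaar H m) {φ : G → ℂ} (hφ : Continuous φ)
    (hφc : HasCompactSupport φ) : Continuous (cosetIntegral H m φ) := by
  have := hm.isFiniteMeasureOnCompacts
  rw [RightCosets.isQuotientMap_mk.continuous_iff]
  refine (continuous_integral_comp_mul_right (m := m) hφ hφc).congr fun x => ?_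
  exact (hm.cosetIntegral_mk φ x).symm

theorem hasCompactSupport_cosetIntegral (hH : IsClosed (H : Set G)) (hm : IsSubgroupHaar H m)
    {φ : G → ℂ} (hφc : HasCompactSupport φ) : HasCompactSupport (cosetIntegral H m φ) := by
  have := RightCosets.t2Space hH
  refine HasCompactSupport.intro (hφc.isCompact.image (RightCosets.continuous_mk (H := H)))
    fun q hq => ?_
  obtain ⟨x, rfl⟩ := RightCosets.mk_surjective q
  rw [hm.cosetIntegral_mk]
  refine integral_eq_zero_of_ae ?_
  filter_upwards [hm.ae_mem] with k hk
  by_contra h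
  refine hq ⟨k * x, subset_tsupport _ h, ?_⟩
  exact RightCosets.mk_eq_mk.2 (by simpa using H.inv_mem hk)

theorem integral_quotientMeasure_eq (hm : IsSubgroupHaar H m) (hβ : IsCosetWeight m β)
    {F : RightCosets H → ℂ} (hF : Continuous F) {ψ : G → ℂ} (hψ : Continuous ψ)
    (hψc : HasCompactSupport ψ) (h : ∀ x, F (RightCosets.mk H x) = ∫ k, ψ (k * x) ∂m) :
    ∫ q, F q ∂(quotientMeasure H β dg) = ∫ x, ψ x ∂dg := by
  have := hm.sigmaFinite
  have hmp := hm.measurePreserving_mul (dg := dg) hβ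
  have hint : Integrable ψ dg := hψ.integrable_of_hasCompactSupport hψc
  have hint' := hmp.integrable_comp_of_integrable hint
  rw [quotientMeasure, integral_map RightCosets.measurable_mk.aemeasurable
    hF.aestronglyMeasurable]
  simp_rw [h]
  conv_rhs => rw [← hmp.map_eq]
  rw [integral_map hmp.measurable.aemeasurable hψ.aestronglyMeasurable]
  exact (integral_prod _ hint').symm

/-- The matrix coefficient of the function `cosetIntegral H m φ`. -/
theorem integral_conj_cosetIntegral_mul (hm : IsSubgroupHaar H m)
    (hβ : IsCosetWeight m β) {φ : G → ℂ} (hφ : Continuous φ) (hφc : HasCompactSupport φ) (g : G) :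
    ∫ q, conj (cosetIntegral H m φ q) * cosetIntegral H m φ (MulOpposite.op g • q)
      ∂(quotientMeasure H β dg) = ∫ k, correlation dg φ g k ∂m := by
  have := hm.isFiniteMeasureOnCompacts
  have hc := hm.continuous_cosetIntegral hφ hφc
  have hcg : Continuous fun q => cosetIntegral H m φ (MulOpposite.op g • q) :=
    hc.comp (continuous_const_smul _)
  -- Only the conjugated factor is unfolded; the other one is constant along cosets and comes out of
  -- the inner integral.
  rw [hm.integral_quotientMeasure_eq hβ
    (F := fun q => conj (cosetIntegral H m φ q) * cosetIntegral H m φ (MulOpposite.op g • q))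
    (ψ := fun x => conj (φ x) * cosetIntegral H m φ (MulOpposite.op g • RightCosets.mk H x)),
    ← integral_mul_integral_eq hφ hφc]
  · refine integral_congr_ae (Eventually.of_forall fun x => ?_)
    simp only [RightCosets.op_smul_mk, hm.cosetIntegral_mk, mul_assoc]
  · exact (Complex.continuous_conj.comp hc).mul hcg
  · exact (Complex.continuous_conj.comp hφ).mul (hcg.comp RightCosets.continuous_mk)
  · exact HasCompactSupport.mul_right (hφc.comp_left (g := conj) (map_zero _))
  · intro x
    have h : ∀ᵐ k ∂m, conj (φ (k * x)) *
        cosetIntegral H m φ (MulOpposite.op g • RightCosets.mk H (k * x))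
        = conj (φ (k * x)) * cosetIntegral H m φ (MulOpposite.op g • RightCosets.mk H x) := by
      filter_upwards [hm.ae_mem] with k hk
      have : RightCosets.mk H (k * x) = RightCosets.mk H x :=
        RightCosets.mk_eq_mk.2 (by simpa using H.inv_mem hk)
      rw [this]
    rw [integral_congr_ae h, integral_mul_const, integral_conj, hm.cosetIntegral_mk]

/-- Every compactly supported continuous function on `H \ G` is of the form
`cosetIntegral H m φ`. -/
theorem exists_cosetIntegral_eq (hm : IsSubgroupHaar H m)
    {f : RightCosets H → ℂ} (hf : Continuous f) (hfc : HasCompactSupport f) :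
    ∃ φ : G → ℂ, Continuous φ ∧ HasCompactSupport φ ∧ cosetIntegral H m φ = f := by
  have := hm.isFiniteMeasureOnCompacts
  obtain ⟨C, hC, hfC⟩ := RightCosets.exists_isCompact_subset_image_mk hfc.isCompact
  obtain ⟨η, hη1, -, hηc, hη01⟩ := exists_continuous_one_zero_of_isCompact hC isClosed_empty
    (Set.disjoint_empty C)
  let W : G → ℝ := fun x => ∫ k, η (k * x) ∂m
  have hW : Continuous W := continuous_integral_comp_mul_right η.continuous hηc
  have hWk : ∀ x, ∀ k ∈ H, W (k * x) = W x := by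
    intro x k hk
    have h := hm.integral_mul_eq_of_mk_eq (fun y => (η y : ℂ)) (x := k * x) (y := x)
      (RightCosets.mk_eq_mk.2 (by simpa using H.inv_mem hk))
    rw [integral_complex_ofReal, integral_complex_ofReal] at h
    exact_mod_cast h
  have hWpos : ∀ x ∈ C, 0 < W x := by
    intro x hx
    have hcx : Continuous fun k => η (k * x) := η.continuous.comp (continuous_mul_const x)
    refine (integral_pos_iff_support_of_nonneg (fun k => (hη01 _).1)
      (hcx.integrable_of_hasCompactSupport (hηc.comp_mul_right x))).2 ?_
    refine hm.measure_pos_of_mem_nhds_one (hcx.isOpen_support.mem_nhds ?_)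
    simp [hη1 hx]
  -- Truncating `W` below at `δ` gives a continuous, nowhere vanishing denominator. The truncation
  -- is inactive on cosets meeting `C`, and these include all those where `f` is nonzero.
  obtain ⟨δ, hδ, hδW⟩ := hC.exists_forall_le' hW.continuousOn hWpos
  have hmax : ∀ x, (max (W x) δ : ℝ) ≠ 0 := fun x => (lt_max_of_lt_right hδ).ne'
  let φ : G → ℂ := fun x => η x * (f (RightCosets.mk H x) / (max (W x) δ : ℝ))
  refine ⟨φ, ?_, ?_, ?_⟩
  · refine (Complex.continuous_ofReal.comp η.continuous).mul
      ((hf.comp RightCosets.continuous_mk).div ?_ fun x => ?_)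
    · exact Complex.continuous_ofReal.comp (hW.max continuous_const)
    · exact_mod_cast hmax x
  · exact HasCompactSupport.mul_right (hηc.comp_left (g := Complex.ofReal) Complex.ofReal_zero)
  · ext q
    obtain ⟨x, rfl⟩ := RightCosets.mk_surjective q
    have h : ∀ᵐ k ∂m, φ (k * x)
        = η (k * x) * (f (RightCosets.mk H x) / (max (W x) δ : ℝ)) := by
      filter_upwards [hm.ae_mem] with k hk
      have hkx : RightCosets.mk H (k * x) = RightCosets.mk H x :=
        RightCosets.mk_eq_mk.2 (by simpa using H.inv_mem hk)
      simp only [φ, hkx, hWk x k hk]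
    rw [hm.cosetIntegral_mk, integral_congr_ae h, integral_mul_const, integral_complex_ofReal]
    by_cases h0 : f (RightCosets.mk H x) = 0
    · simp [h0]
    · obtain ⟨c, hc, hcx⟩ := hfC (subset_tsupport _ h0)
      have hWc : W x = W c := by
        have := hWk c (x * c⁻¹) (RightCosets.mk_eq_mk.1 hcx)
        rw [← this]
        simp
      have hWx : δ ≤ W x := hWc ▸ hδW c hc
      have hne : (W x : ℂ) ≠ 0 := by exact_mod_cast (hδ.trans_le hWx).ne'
      change (W x : ℂ) * _ = _
      rw [max_eq_left hWx]
      field_simp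

end IsSubgroupHaar

end CosetIntegral

/-! ### Limits of Haar measures of subgroups -/

section Limit

open Pointwise CompactlySupported

theorem norm_integral_le_mul_of_support_subset {X E : Type*} [MeasurableSpace X]
    [NormedAddCommGroup E] [NormedSpace ℝ E] {m : Measure X} {f : X → E} {L : Set X} {B : ℝ}
    {C : NNReal} (hf : ∀ x ∉ L, f x = 0) (hB : ∀ x ∈ L, ‖f x‖ ≤ B) (hB0 : 0 ≤ B) (hC : m L ≤ C) :
    ‖∫ x, f x ∂m‖ ≤ B * C := by
  rw [← setIntegral_eq_integral_of_forall_compl_eq_zero hf]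
  refine (norm_setIntegral_le_of_norm_le_const (hC.trans_lt ENNReal.coe_lt_top) hB).trans ?_
  gcongr
  exact ENNReal.toReal_le_coe_of_le_coe hC

variable {G : Type*} [Group G] [TopologicalSpace G] [MeasurableSpace G]
  [IsTopologicalGroup G] [BorelSpace G] [PolishSpace G] [LocallyCompactSpace G]

/-- The integrals of a continuous family of functions are equicontinuous with respect to measures
which are bounded on a set containing the supports. -/
theorem eventually_norm_integral_sub_lt {X E : Type*} [TopologicalSpace X]
    [NormedAddCommGroup E] [NormedSpace ℝ E] {F : X → G → E}
    (hF : Continuous F.uncurry) {x₀ : X} {L : Set G} (hL : IsCompact L)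
    (hFL : ∀ᶠ x in 𝓝 x₀, ∀ k ∉ L, F x k = 0) (C : NNReal) {ε : ℝ} (hε : 0 < ε) :
    ∀ᶠ x in 𝓝 x₀, ∀ m : Measure G, IsFiniteMeasureOnCompacts m → m L ≤ C →
      ‖∫ k, F x k ∂m - ∫ k, F x₀ k ∂m‖ < ε := by
  -- `C` may be zero, whence `C + 1`; the final bound is `ε * C / (C + 1) < ε`.
  have hδ : 0 < ε / (C + 1) := by positivity
  have h1 : ∀ᶠ x in 𝓝 x₀, ∀ k ∈ L, ‖F x k - F x₀ k‖ < ε / (C + 1) := by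
    refine hL.eventually_forall_of_forall_eventually fun k _ => ?_
    have hc : Continuous fun z : X × G => ‖F z.1 z.2 - F x₀ z.2‖ :=
      ((hF.comp continuous_id).sub (hF.comp (continuous_const.prodMk continuous_snd))).norm
    have := hc.tendsto (x₀, k)
    simp only [sub_self, norm_zero] at this
    exact this.eventually (gt_mem_nhds hδ)
  have hsupp : ∀ x, (∀ k ∉ L, F x k = 0) → HasCompactSupport (F x) := fun x hx =>
    HasCompactSupport.intro hL hx
  have hcont : ∀ x, Continuous (F x) := fun x => hF.comp (continuous_const.prodMk continuous_id)
  filter_upwards [h1, hFL] with x hx1 hx2 m hm hC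
  have hx0 : ∀ k ∉ L, F x₀ k = 0 := hFL.self_of_nhds
  rw [← integral_sub ((hcont x).integrable_of_hasCompactSupport (hsupp x hx2))
    ((hcont x₀).integrable_of_hasCompactSupport (hsupp x₀ hx0))]
  refine (norm_integral_le_mul_of_support_subset (L := L) (fun k hk => ?_)
    (fun k hk => (hx1 k hk).le) hδ.le hC).trans_lt ?_
  · rw [hx2 k hk, hx0 k hk, sub_zero]
  · rw [div_mul_eq_mul_div, div_lt_iff₀ (by positivity)]
    nlinarith

/-- The Haar measures of subgroups which are normalized on a neighborhood of the identity are
uniformly bounded on compact sets. -/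
theorem exists_forall_subgroupHaar_le {ι : Type*} {Γ : ι → Subgroup G} {m : ι → Measure G}
    (hm : ∀ n, IsSubgroupHaar (Γ n) (m n)) {V : Set G} (hV : V ∈ 𝓝 (1 : G))
    (hmV : ∀ n, m n V ≤ 1) {L : Set G} (hL : IsCompact L) : ∃ C : NNReal, ∀ n, m n L ≤ C := by
  obtain ⟨K, hK, hK1, hKV⟩ : ∃ K : Set G, IsCompact K ∧ K ∈ 𝓝 (1 : G) ∧ K * K⁻¹ ⊆ V := by
    have hc : Tendsto (fun p : G × G => p.1 * p.2⁻¹) (𝓝 (1, 1)) (𝓝 1) := by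
      have h : Continuous fun p : G × G => p.1 * p.2⁻¹ := by fun_prop
      simpa using h.tendsto (1, 1)
    have hW := hc hV
    rw [nhds_prod_eq, mem_map, mem_prod_same_iff] at hW
    obtain ⟨W, hW, hWV⟩ := hW
    obtain ⟨K, hK1, hKW, hK⟩ := local_compact_nhds hW
    refine ⟨K, hK, hK1, ?_⟩
    rintro _ ⟨a, ha, b, hb, rfl⟩
    simpa using hWV (Set.mk_mem_prod (hKW ha) (hKW (Set.mem_inv.1 hb)))
  -- Each translate of `K` has mass at most that of `K * K⁻¹ ⊆ V`, hence at most one, so the number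
  -- of translates covering `L` bounds its mass for every `n`.
  obtain ⟨t, -, ht⟩ := hL.elim_nhds_subcover (fun x => {k | k * x⁻¹ ∈ K}) fun x _ => by
    refine (continuous_mul_const x⁻¹).continuousAt.preimage_mem_nhds ?_
    simpa using hK1
  refine ⟨t.card, fun n => (measure_mono ht).trans ((measure_biUnion_finset_le _ _).trans ?_)⟩
  calc ∑ x ∈ t, m n {k | k * x⁻¹ ∈ K} ≤ ∑ x ∈ t, 1 := Finset.sum_le_sum fun x _ =>
        ((hm n).measure_mul_mem_le K hK x⁻¹).trans ((measure_mono hKV).trans (hmV n))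
    _ = _ := by simp

/-- Existence of limits, along an ultrafilter, of measures that are uniformly bounded on compact
sets. -/
theorem exists_measure_tendsto_integral {ι : Type*} (U : Ultrafilter ι) {m : ι → Measure G}
    (hm : ∀ n, IsFiniteMeasureOnCompacts (m n))
    (hb : ∀ L : Set G, IsCompact L → ∃ C : NNReal, ∀ n, m n L ≤ C) :
    ∃ μ : Measure G, μ.Regular ∧ ∀ f : G → ℝ, Continuous f → HasCompactSupport f →
      Tendsto (fun n => ∫ x, f x ∂(m n)) U (𝓝 (∫ x, f x ∂μ)) := by
  have hlim : ∀ f : C_c(G, ℝ), ∃ a, Tendsto (fun n => ∫ x, f x ∂(m n)) U (𝓝 a) := by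
    intro f
    obtain ⟨C, hC⟩ := hb _ f.hasCompactSupport.isCompact
    obtain ⟨B, hB⟩ := f.hasCompactSupport.exists_bound_of_continuous f.continuous
    have hB0 : 0 ≤ B := (norm_nonneg _).trans (hB 1)
    have hmem : ∀ n, ∫ x, f x ∂(m n) ∈ Metric.closedBall (0 : ℝ) (B * C) := fun n => by
      rw [mem_closedBall_zero_iff]
      exact norm_integral_le_mul_of_support_subset (fun x hx => image_eq_zero_of_notMem_tsupport hx)
        (fun x _ => hB x) hB0 (hC n)
    obtain ⟨a, -, ha⟩ := (isCompact_closedBall (0 : ℝ) (B * C)).ultrafilter_le_nhds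
      (U.map fun n => ∫ x, f x ∂(m n)) (le_principal_iff.2 (Filter.mem_map.2 (Eventually.of_forall hmem)))
    exact ⟨a, ha⟩
  choose Λ hΛ using hlim
  have hint : ∀ (f : C_c(G, ℝ)) n, Integrable f (m n) := fun f n =>
    f.continuous.integrable_of_hasCompactSupport f.hasCompactSupport
  let Λ' : C_c(G, ℝ) →ₗ[ℝ] ℝ :=
    { toFun := Λ
      map_add' := fun f g => by
        refine tendsto_nhds_unique (hΛ (f + g)) (((hΛ f).add (hΛ g)).congr fun n => ?_)
        exact (integral_add (hint f n) (hint g n)).symm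
      map_smul' := fun c f => by
        refine tendsto_nhds_unique (hΛ (c • f)) (((hΛ f).const_smul c).congr fun n => ?_)
        exact (integral_smul c f).symm }
  -- The limit functional is positive, so the Riesz–Markov–Kakutani theorem represents it by a
  -- regular measure.
  let Λp : C_c(G, ℝ) →ₚ[ℝ] ℝ := PositiveLinearMap.mk₀ Λ' fun f hf =>
    ge_of_tendsto' (hΛ f) fun n => integral_nonneg fun x => hf x
  refine ⟨RealRMK.rieszMeasure Λp, inferInstance, fun f hf hfc => ?_⟩
  have := RealRMK.integral_rieszMeasure Λp ⟨⟨f, hf⟩, hfc⟩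
  have h2 := hΛ ⟨⟨f, hf⟩, hfc⟩
  exact this ▸ h2

/-- The normalization on `V` prevents the limit from vanishing. Cluster points of the `Γ n` lying in
`H` confine it to `H`; approximating `h ∈ H` by elements of the `Γ n` gives left invariance;
inversion invariance passes directly to the limit. -/
theorem exists_isSubgroupHaar_tendsto_integral {Γ : ℕ → Subgroup G} {H : Subgroup G}
    (hH : IsClosed (H : Set G)) (hlim : ChabautyTendsto Γ H) {U : Ultrafilter ℕ}
    (hU : (U : Filter ℕ) ≤ atTop) {m : ℕ → Measure G}
    (hm : ∀ n, IsSubgroupHaar (Γ n) (m n)) {V : Set G} (hV : V ∈ 𝓝 (1 : G)) (hVc : IsCompact V)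
    (hmV : ∀ n, m n V = 1) :
    ∃ μ : Measure G, IsSubgroupHaar H μ ∧ ∀ f : G → ℝ, Continuous f → HasCompactSupport f →
      Tendsto (fun n => ∫ x, f x ∂(m n)) U (𝓝 (∫ x, f x ∂μ)) := by
  have hmf : ∀ n, IsFiniteMeasureOnCompacts (m n) := fun n => (hm n).isFiniteMeasureOnCompacts
  have hb : ∀ L : Set G, IsCompact L → ∃ C : NNReal, ∀ n, m n L ≤ C := fun L hL =>
    exists_forall_subgroupHaar_le hm hV (fun n => (hmV n).le) hL
  obtain ⟨μ, hμr, hμ⟩ := exists_measure_tendsto_integral U hmf hb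
  refine ⟨μ, ⟨inferInstance, ?_, ?_, ?_, ?_⟩, hμ⟩
  · rintro rfl
    obtain ⟨f, hf1, -, hfc, hf01⟩ := exists_continuous_one_zero_of_isCompact hVc isClosed_empty
      (Set.disjoint_empty V)
    have h1 : ∀ n, 1 ≤ ∫ x, f x ∂(m n) := by
      intro n
      have hi : Integrable f (m n) := f.continuous.integrable_of_hasCompactSupport hfc
      calc (1 : ℝ) = ∫ x in V, f x ∂(m n) := by
            rw [setIntegral_congr_fun hVc.measurableSet hf1]
            simp [Measure.real, hmV n]
        _ ≤ ∫ x, f x ∂(m n) :=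
            setIntegral_le_integral hi (Eventually.of_forall fun x => (hf01 x).1)
    have h2 := ge_of_tendsto' (hμ f f.continuous hfc) h1
    rw [integral_zero_measure] at h2
    exact absurd h2 (by norm_num)
  · refine measure_null_of_locally_null _ fun x hx => ?_
    obtain ⟨K, hKx, hKH, hK⟩ := local_compact_nhds (hH.isOpen_compl.mem_nhds hx)
    obtain ⟨f, hf1, hf0, hfc, hf01⟩ := exists_continuous_one_zero_of_isCompact
      (isCompact_singleton (x := x)) isOpen_interior.isClosed_compl
      (Set.disjoint_singleton_left.2 fun h => h (mem_interior_iff_mem_nhds.2 hKx))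
    have hdisj : ∀ᶠ n in U, ∀ g ∈ Γ n, g ∉ K := by
      by_contra hcon
      rw [← Ultrafilter.eventually_not] at hcon
      -- The value `1` is a default where `Γ n` misses `K`. Along `U` the chosen elements lie in
      -- `K`, so they have a cluster point there, which must belong to `H`: a contradiction.
      have hex : ∀ n, ∃ g ∈ Γ n, (¬ ∀ g ∈ Γ n, g ∉ K) → g ∈ K := by
        intro n
        by_cases h : ∀ g ∈ Γ n, g ∉ K
        · exact ⟨1, one_mem _, fun h' => absurd h h'⟩
        · push Not at h
          obtain ⟨g, hg, hgK⟩ := h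
          exact ⟨g, hg, fun _ => hgK⟩
      choose g hgΓ hgK using hex
      obtain ⟨y, hyK, hy⟩ := hK.ultrafilter_le_nhds (U.map g)
        (le_principal_iff.2 (hcon.mono fun n hn => hgK n hn))
      have hcl : MapClusterPt y U g := Filter.Tendsto.mapClusterPt hy
      exact hKH hyK (hlim.2 g hgΓ y (hcl.mono hU))
    have hint : ∫ x, f x ∂μ = 0 := by
      refine tendsto_nhds_unique (hμ f f.continuous hfc) (tendsto_const_nhds.congr' ?_)
      filter_upwards [hdisj] with n hn
      refine (integral_eq_zero_of_ae ?_).symm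
      filter_upwards [(hm n).ae_mem] with k hk
      exact hf0 fun hkK => hn k hk (interior_subset hkK)
    have hae := (integral_eq_zero_iff_of_nonneg (fun x => (hf01 x).1)
      (f.continuous.integrable_of_hasCompactSupport hfc)).1 hint
    refine ⟨Function.support f, mem_nhdsWithin_of_mem_nhds
      (f.continuous.isOpen_support.mem_nhds ?_), ae_iff.1 hae⟩
    simp [hf1 (Set.mem_singleton x)]
  · intro h hh
    obtain ⟨γ, hγ, hγh⟩ := hlim.1 h hh
    have : (μ.map fun k => h * k).Regular := Measure.Regular.map (Homeomorph.mulLeft h)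
    refine Measure.ext_of_integral_eq_on_compactlySupported fun f => ?_
    have hf : Continuous ⇑f := f.continuous
    have hfh : Continuous fun k => f (h * k) := f.continuous.comp (continuous_const_mul h)
    have hfhc : HasCompactSupport fun k => f (h * k) :=
      f.hasCompactSupport.comp_homeomorph (Homeomorph.mulLeft h)
    rw [integral_map (continuous_const_mul h).measurable.aemeasurable
      hf.aestronglyMeasurable]
    have h1 := hμ _ hfh hfhc
    have h2 := hμ f f.continuous f.hasCompactSupport
    refine tendsto_nhds_unique h1 ?_
    have hγi : ∀ n, ∫ k, f (γ n * k) ∂(m n) = ∫ k, f k ∂(m n) := by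
      intro n
      conv_rhs => rw [← (hm n).map_mul_left _ (hγ n)]
      rw [integral_map (continuous_const_mul _).measurable.aemeasurable
        hf.aestronglyMeasurable]
    refine h2.congr_dist ?_
    rw [Metric.tendsto_nhds]
    intro ε hε
    obtain ⟨P, hP, hPh⟩ := exists_compact_mem_nhds h
    have hL : IsCompact (P⁻¹ * tsupport f) := hP.inv.mul f.hasCompactSupport.isCompact
    obtain ⟨C, hC⟩ := hb _ hL
    -- Since `γ n` preserves `m n`, it suffices that replacing `γ n` by `h` changes the integral
    -- little, uniformly over the measures `m n`.
    have hev := eventually_norm_integral_sub_lt (F := fun g k => f (g * k)) (x₀ := h)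
      (f.continuous.comp continuous_mul) hL ?_ C hε
    · filter_upwards [(hγh.mono_left hU).eventually hev] with n hn
      have h3 := hn (m n) (hmf n) (hC n)
      rw [hγi] at h3
      simpa [Real.dist_eq] using h3
    · filter_upwards [hPh] with g hg k hk
      by_contra h0
      exact hk ⟨g⁻¹, Set.inv_mem_inv.2 hg, g * k, subset_tsupport _ h0, by simp⟩
  · have : (μ.map fun k => k⁻¹).Regular := Measure.Regular.map (Homeomorph.inv G)
    refine Measure.ext_of_integral_eq_on_compactlySupported fun f => ?_
    have hf : Continuous ⇑f := f.continuous
    have hfi : Continuous fun k => f k⁻¹ := f.continuous.comp continuous_inv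
    have hfic : HasCompactSupport fun k => f k⁻¹ :=
      f.hasCompactSupport.comp_homeomorph (Homeomorph.inv G)
    rw [integral_map continuous_inv.measurable.aemeasurable hf.aestronglyMeasurable]
    refine tendsto_nhds_unique (hμ _ hfi hfic)
      ((hμ f f.continuous f.hasCompactSupport).congr fun n => ?_)
    conv_lhs => rw [← (hm n).map_inv]
    rw [integral_map continuous_inv.measurable.aemeasurable hf.aestronglyMeasurable]

theorem tendsto_integral_complex {ι : Type*} {l : Filter ι} {m : ι → Measure G} {μ : Measure G}
    (hm : ∀ n, IsFiniteMeasureOnCompacts (m n)) (hμf : IsFiniteMeasureOnCompacts μ)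
    (hμ : ∀ f : G → ℝ, Continuous f → HasCompactSupport f →
      Tendsto (fun n => ∫ x, f x ∂(m n)) l (𝓝 (∫ x, f x ∂μ)))
    {f : G → ℂ} (hf : Continuous f) (hfc : HasCompactSupport f) :
    Tendsto (fun n => ∫ x, f x ∂(m n)) l (𝓝 (∫ x, f x ∂μ)) := by
  have hre := hμ _ (Complex.continuous_re.comp hf) (hfc.comp_left Complex.zero_re)
  have him := hμ _ (Complex.continuous_im.comp hf) (hfc.comp_left Complex.zero_im)
  have h : ∀ (ν : Measure G), IsFiniteMeasureOnCompacts ν → ∫ x, f x ∂ν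
      = ((∫ x, (Complex.re ∘ f) x ∂ν : ℝ) : ℂ) + ((∫ x, (Complex.im ∘ f) x ∂ν : ℝ) : ℂ) * Complex.I :=
    fun ν _ => (integral_re_add_im (hf.integrable_of_hasCompactSupport hfc)).symm
  rw [h μ hμf]
  refine Tendsto.congr (fun n => (h (m n) (hm n)).symm) ?_
  exact ((Complex.continuous_ofReal.tendsto _).comp hre).add
    (((Complex.continuous_ofReal.tendsto _).comp him).mul_const _)

/-- Pointwise convergence of integrals of a continuous family of functions is locally uniform. -/
theorem eventually_forall_norm_integral_sub_lt {ι : Type*} {l : Filter ι} {m : ι → Measure G}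
    {μ : Measure G} (hm : ∀ n, IsFiniteMeasureOnCompacts (m n)) (hμf : IsFiniteMeasureOnCompacts μ)
    (hb : ∀ L : Set G, IsCompact L → ∃ C : NNReal, ∀ n, m n L ≤ C)
    (hμ : ∀ f : G → ℝ, Continuous f → HasCompactSupport f →
      Tendsto (fun n => ∫ x, f x ∂(m n)) l (𝓝 (∫ x, f x ∂μ)))
    {X : Type*} [TopologicalSpace X] {F : X → G → ℂ} (hF : Continuous F.uncurry)
    (hFL : ∀ x₀, ∃ L : Set G, IsCompact L ∧ ∀ᶠ x in 𝓝 x₀, ∀ k ∉ L, F x k = 0)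
    {Q : Set X} (hQ : IsCompact Q) {ε : ℝ} (hε : 0 < ε) :
    ∀ᶠ n in l, ∀ x ∈ Q, ‖∫ k, F x k ∂μ - ∫ k, F x k ∂(m n)‖ < ε := by
  refine hQ.induction_on (p := fun Q => ∀ᶠ n in l, ∀ x ∈ Q,
    ‖∫ k, F x k ∂μ - ∫ k, F x k ∂(m n)‖ < ε) (by simp) (fun s t hst ht => ?_)
    (fun s t hs ht => ?_) fun x₀ _ => ?_
  · filter_upwards [ht] with n hn x hx using hn x (hst hx)
  · filter_upwards [hs, ht] with n hn hn' x hx using hx.elim (hn x) (hn' x)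
  obtain ⟨L, hL, hx₀⟩ := hFL x₀
  obtain ⟨C, hC⟩ := hb L hL
  have hε3 : 0 < ε / 3 := by positivity
  -- Near `x₀` the integrals against all `m n` and against `μ` vary by less than `ε / 3`, so
  -- convergence at the single point `x₀` suffices.
  have h1 := eventually_norm_integral_sub_lt hF hL hx₀ C hε3
  have h2 := eventually_norm_integral_sub_lt hF hL hx₀ (μ L).toNNReal hε3
  refine ⟨_, mem_nhdsWithin_of_mem_nhds (h1.and h2), ?_⟩
  have hFc : Continuous (F x₀) := hF.comp (continuous_const.prodMk continuous_id)
  have h3 := tendsto_integral_complex hm hμf hμ hFc (HasCompactSupport.intro hL hx₀.self_of_nhds)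
  filter_upwards [Metric.tendsto_nhds.1 h3 _ hε3] with n hn x hx
  have e1 := hx.1 (m n) (hm n) (hC n)
  have e2 := hx.2 μ hμf (ENNReal.coe_toNNReal hL.measure_lt_top.ne).ge
  rw [dist_eq_norm] at hn
  rw [norm_sub_rev] at e1 hn
  calc ‖∫ k, F x k ∂μ - ∫ k, F x k ∂(m n)‖
      = ‖(∫ k, F x k ∂μ - ∫ k, F x₀ k ∂μ) + (∫ k, F x₀ k ∂μ - ∫ k, F x₀ k ∂(m n))
          + (∫ k, F x₀ k ∂(m n) - ∫ k, F x k ∂(m n))‖ := by congr 1; ring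
    _ ≤ _ := norm_add₃_le
    _ < ε := by linarith

end Limit

/-! ### Normalized counting measures of discrete subgroups, and unimodularity. -/

section Unimodular

variable {G : Type*} [Group G] [TopologicalSpace G] [MeasurableSpace G]
  [IsTopologicalGroup G] [BorelSpace G]

theorem IsSubgroupHaar.smul {H : Subgroup G} {m : Measure G} (hm : IsSubgroupHaar H m) {c : ℝ≥0∞}
    (hc0 : c ≠ 0) (hc : c ≠ ∞) : IsSubgroupHaar H (c • m) where
  isFiniteMeasureOnCompacts := by
    have := hm.isFiniteMeasureOnCompacts
    exact IsFiniteMeasureOnCompacts.smul m hc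
  ne_zero := by
    intro h
    refine hm.ne_zero (Measure.measure_univ_eq_zero.1 ?_)
    have := congrArg (fun ν : Measure G => ν Set.univ) h
    simpa [hc0] using this
  compl_eq_zero := by simp [hm.compl_eq_zero]
  map_mul_left h hh := by rw [Measure.map_smul, hm.map_mul_left h hh]
  map_inv := by rw [Measure.map_smul, hm.map_inv]

variable [PolishSpace G] [LocallyCompactSpace G]

theorem isSubgroupHaar_count_restrict (Γ : Subgroup G) [DiscreteTopology Γ] :
    IsSubgroupHaar Γ (Measure.count.restrict (Γ : Set G)) where
  isFiniteMeasureOnCompacts := by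
    refine ⟨fun K hK => ?_⟩
    have hΓ : IsClosed (Γ : Set G) := Subgroup.isClosed_of_discrete
    rw [Measure.restrict_apply hK.measurableSet, Measure.count_apply_lt_top]
    refine (hK.inter_right hΓ).finite ?_
    exact IsDiscrete.mono (isDiscrete_iff_discreteTopology.2 ‹_›) Set.inter_subset_right
  ne_zero h := by
    have h1 : (Measure.count.restrict (Γ : Set G)) {1} = 1 := by
      rw [Measure.restrict_apply (measurableSet_singleton _),
        Set.inter_eq_left.2 (by simp), Measure.count_singleton]
    rw [h] at h1
    simp at h1
  compl_eq_zero := by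
    have hΓ : IsClosed (Γ : Set G) := Subgroup.isClosed_of_discrete
    rw [Measure.restrict_apply hΓ.measurableSet.compl]
    simp
  map_mul_left h hh := by
    have hΓ : IsClosed (Γ : Set G) := Subgroup.isClosed_of_discrete
    have h1 : (fun k => h * k) ⁻¹' (Γ : Set G) = Γ := by
      ext k
      simp [Γ.mul_mem_cancel_left hh]
    conv_lhs => rw [← h1]
    rw [← Measure.restrict_map (continuous_const_mul h).measurable hΓ.measurableSet,
      map_mul_left_eq_self]
  map_inv := by
    have hΓ : IsClosed (Γ : Set G) := Subgroup.isClosed_of_discrete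
    have h1 : (fun k => k⁻¹) ⁻¹' (Γ : Set G) = Γ := by
      ext k
      simp
    conv_lhs => rw [← h1]
    rw [← Measure.restrict_map continuous_inv.measurable hΓ.measurableSet]
    exact congrArg (fun ν : Measure G => ν.restrict (Γ : Set G)) (Measure.map_inv_eq_self _)

theorem exists_isSubgroupHaar_of_discrete (Γ : Subgroup G) [DiscreteTopology Γ] {V : Set G}
    (hV : V ∈ 𝓝 (1 : G)) (hVc : IsCompact V) : ∃ m, IsSubgroupHaar Γ m ∧ m V = 1 := by
  have h := isSubgroupHaar_count_restrict Γ
  have := h.isFiniteMeasureOnCompacts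
  have h0 := (h.measure_pos_of_mem_nhds_one hV).ne'
  have htop := hVc.measure_lt_top (μ := Measure.count.restrict (Γ : Set G)).ne
  refine ⟨_, h.smul (ENNReal.inv_ne_zero.2 htop) (ENNReal.inv_ne_top.2 h0), ?_⟩
  rw [Measure.smul_apply, smul_eq_mul, ENNReal.inv_mul_cancel h0 htop]

/-- Restricting `m` to `H` keeps both invariances. An invariant measure is Haar once one compact
neighbourhood of the identity has positive finite mass. -/
theorem IsSubgroupHaar.isUnimodularSubgroup {H : Subgroup G} (hH : IsClosed (H : Set G))
    {m : Measure G} (hm : IsSubgroupHaar H m) : IsUnimodularSubgroup H := by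
  have := hm.isFiniteMeasureOnCompacts
  have hemb : MeasurableEmbedding (Subtype.val : H → G) :=
    hH.isClosedEmbedding_subtypeVal.measurableEmbedding
  have : LocallyCompactSpace H := hH.isClosedEmbedding_subtypeVal.locallyCompactSpace
  let ν : Measure H := m.comap Subtype.val
  have hν : ∀ s, ν s = m (Subtype.val '' s) := fun s => hemb.comap_apply m s
  have hl : ν.IsMulLeftInvariant := by
    refine ⟨fun h => Measure.ext fun s hs => ?_⟩
    rw [Measure.map_apply (measurable_const_mul h) hs, hν, hν]
    conv_rhs => rw [← hm.map_mul_left h h.2, Measure.map_apply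
      (continuous_const_mul (h : G)).measurable (hemb.measurableSet_image.2 hs)]
    congr 1
    ext k
    simp only [Set.mem_image, Set.mem_preimage, Subtype.exists, exists_and_right, exists_eq_right]
    constructor
    · rintro ⟨hk, hks⟩
      exact ⟨H.mul_mem h.2 hk, hks⟩
    · rintro ⟨hk, hks⟩
      exact ⟨(H.mul_mem_cancel_left h.2).1 hk, hks⟩
  have hr : ν.IsMulRightInvariant := by
    refine ⟨fun h => Measure.ext fun s hs => ?_⟩
    rw [Measure.map_apply (measurable_mul_const h) hs, hν, hν]
    conv_rhs => rw [← hm.map_mul_right h.2, Measure.map_apply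
      (continuous_mul_const (h : G)).measurable (hemb.measurableSet_image.2 hs)]
    congr 1
    ext k
    simp only [Set.mem_image, Set.mem_preimage, Subtype.exists, exists_and_right, exists_eq_right]
    constructor
    · rintro ⟨hk, hks⟩
      exact ⟨H.mul_mem hk h.2, hks⟩
    · rintro ⟨hk, hks⟩
      exact ⟨(H.mul_mem_cancel_right h.2).1 hk, hks⟩
  obtain ⟨V, hV, hV1⟩ := exists_compact_mem_nhds (1 : G)
  let K : Set H := Subtype.val ⁻¹' V
  have hK : IsCompact K := hH.isClosedEmbedding_subtypeVal.isCompact_preimage hV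
  have hK1 : K ∈ 𝓝 (1 : H) := continuous_subtype_val.continuousAt.preimage_mem_nhds hV1
  have hVK : ν K = m V := by
    have h1 : Subtype.val '' K = V ∩ H := by
      ext k
      simp [K, and_comm]
    rw [hν, h1]
    exact measure_congr (by
      filter_upwards [hm.ae_mem] with k hk
      exact propext ⟨fun h => h.1, fun h => ⟨h, hk⟩⟩)
  refine ⟨ν, Measure.isHaarMeasure_of_isCompact_nonempty_interior ν K hK
    ⟨1, mem_interior_iff_mem_nhds.2 hK1⟩ ?_ ?_, hr⟩
  · rw [hVK]
    exact (hm.measure_pos_of_mem_nhds_one hV1).ne'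
  · rw [hVK]
    exact hV.measure_lt_top.ne

end Unimodular

/-! ### Matrix coefficients of translation representations -/

section MatrixCoefficients

open ComplexConjugate

/-- The bound is independent of `g`, so it suffices to approximate coefficients of a dense set of
vectors. -/
theorem UnitaryRep.norm_diagCoeff_sub_le {G : Type*} [Group G] [TopologicalSpace G]
    {V : Type*} [NormedAddCommGroup V] [InnerProductSpace ℂ V] (π : UnitaryRep G V) (v w : V)
    (g : G) : ‖π.diagCoeff v g - π.diagCoeff w g‖ ≤ ‖v - w‖ * (‖v‖ + ‖w‖) := by
  have h : π.diagCoeff v g - π.diagCoeff w g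
      = inner ℂ (v - w) (π.toHom g v) + inner ℂ w (π.toHom g (v - w)) := by
    simp only [UnitaryRep.diagCoeff, map_sub, inner_sub_left, inner_sub_right]
    ring
  rw [h]
  refine (norm_add_le _ _).trans ?_
  have h1 := norm_inner_le_norm (𝕜 := ℂ) (v - w) (π.toHom g v)
  have h2 := norm_inner_le_norm (𝕜 := ℂ) w (π.toHom g (v - w))
  rw [LinearIsometryEquiv.norm_map] at h1 h2
  linarith

variable {G : Type*} [Group G] [TopologicalSpace G]
  {X : Type*} [TopologicalSpace X] [R1Space X] [MeasurableSpace X] [BorelSpace X]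
  [MulAction Gᵐᵒᵖ X] [ContinuousSMul Gᵐᵒᵖ X]

theorem diagCoeff_rightTranslationRep (μ : Measure X) [μ.Regular] [IsLocallyFiniteMeasure μ]
    [SMulInvariantMeasure Gᵐᵒᵖ X μ] (v : Lp ℂ 2 μ) (g : G) :
    (rightTranslationRep μ).diagCoeff v g = ∫ x, conj (v x) * v (MulOpposite.op g • x) ∂μ := by
  rw [UnitaryRep.diagCoeff, L2.inner_def]
  refine integral_congr_ae ?_
  filter_upwards [rightTranslationRep_ae_eq μ g v] with x hx
  rw [hx, RCLike.inner_apply, mul_comm]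

theorem diagCoeff_rightTranslationRep_toLp (μ : Measure X) [μ.Regular] [IsLocallyFiniteMeasure μ]
    [SMulInvariantMeasure Gᵐᵒᵖ X μ] {f : X → ℂ} (hf : MemLp f 2 μ) (g : G) :
    (rightTranslationRep μ).diagCoeff (hf.toLp f) g
      = ∫ x, conj (f x) * f (MulOpposite.op g • x) ∂μ := by
  rw [diagCoeff_rightTranslationRep]
  have h1 := hf.coeFn_toLp
  have h2 := (measurePreserving_smul (MulOpposite.op g) μ).quasiMeasurePreserving.ae_eq_comp h1
  refine integral_congr_ae ?_
  filter_upwards [h1, h2] with x hx1 hx2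
  simp only [Function.comp_apply] at hx2
  rw [hx1, hx2]

/-- A function in `L²(μ)` defines, up to a scalar, a vector in `L²(c μ)` with the same matrix
coefficient. -/
theorem exists_diagCoeff_rightTranslationRep_eq_of_smul (μ : Measure X) {ν : Measure X}
    [μ.Regular] [IsLocallyFiniteMeasure μ] [SMulInvariantMeasure Gᵐᵒᵖ X μ] {c : NNReal}
    (hc : c ≠ 0) (h : μ = c • ν) {f : X → ℂ} (hf : MemLp f 2 ν) :
    ∃ w : Lp ℂ 2 μ, ∀ g : G, (rightTranslationRep μ).diagCoeff w g
      = ∫ x, conj (f x) * f (MulOpposite.op g • x) ∂ν := by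
  -- Coefficients are quadratic in the vector, so the factor `c^(-1/2)` offsets the scaling of the
  -- measure.
  let s : ℂ := ((Real.sqrt c)⁻¹ : ℝ)
  have hs : conj s * s * (c : ℝ) = 1 := by
    have h1 : (Real.sqrt c)⁻¹ * (Real.sqrt c)⁻¹ * (c : ℝ) = 1 := by
      rw [← mul_inv, Real.mul_self_sqrt c.coe_nonneg]
      exact inv_mul_cancel₀ (by exact_mod_cast hc)
    simp only [s, Complex.conj_ofReal]
    exact_mod_cast h1
  have hfμ : MemLp f 2 μ := h ▸ hf.smul_measure ENNReal.coe_ne_top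
  refine ⟨(hfμ.const_smul s).toLp _, fun g => ?_⟩
  rw [diagCoeff_rightTranslationRep_toLp]
  have h2 : ∀ x, conj ((s • f) x) * (s • f) (MulOpposite.op g • x)
      = (conj s * s) * (conj (f x) * f (MulOpposite.op g • x)) := fun x => by
    simp only [Pi.smul_apply, smul_eq_mul, map_mul]
    ring
  simp_rw [h2]
  rw [integral_const_mul, h, integral_smul_nnreal_measure, NNReal.smul_def, Complex.real_smul,
    ← mul_assoc, hs, one_mul]

theorem range_diagCoeff_rightTranslationRep_subset_of_smul (μ ν : Measure X)
    [μ.Regular] [IsLocallyFiniteMeasure μ] [SMulInvariantMeasure Gᵐᵒᵖ X μ]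
    [ν.Regular] [IsLocallyFiniteMeasure ν] [SMulInvariantMeasure Gᵐᵒᵖ X ν] {c : NNReal}
    (hc : c ≠ 0) (h : μ = c • ν) :
    Set.range (rightTranslationRep (G := G) ν).diagCoeff
      ⊆ Set.range (rightTranslationRep (G := G) μ).diagCoeff := by
  rintro _ ⟨v, rfl⟩
  obtain ⟨w, hw⟩ := exists_diagCoeff_rightTranslationRep_eq_of_smul (G := G) μ hc h (Lp.memLp v)
  refine ⟨w, funext fun g => ?_⟩
  rw [hw, diagCoeff_rightTranslationRep]

theorem exists_continuous_norm_sub_toLp_le [NormalSpace X] [WeaklyLocallyCompactSpace X] (μ : Measure X)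
    [μ.Regular] (v : Lp ℂ 2 μ) {ε : ℝ} (hε : 0 < ε) :
    ∃ f : X → ℂ, Continuous f ∧ HasCompactSupport f ∧
      ∃ hf : MemLp f 2 μ, ‖v - hf.toLp f‖ ≤ ε := by
  obtain ⟨f, hfc, hfε, hf, hfm⟩ := (Lp.memLp v).exists_hasCompactSupport_eLpNorm_sub_le
    ENNReal.ofNat_ne_top (ENNReal.ofReal_pos.2 hε).ne'
  refine ⟨f, hf, hfc, hfm, ?_⟩
  have h : v - hfm.toLp f = ((Lp.memLp v).sub hfm).toLp _ := by
    rw [MemLp.toLp_sub (Lp.memLp v) hfm, Lp.toLp_coeFn]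
  rw [h, Lp.norm_toLp]
  exact ENNReal.toReal_le_of_le_ofReal hε.le hfε

end MatrixCoefficients

/-! ### Temperedness of Chabauty limits -/

section Main

open Pointwise ComplexConjugate

variable {G : Type*} [Group G] [TopologicalSpace G] [IsTopologicalGroup G] [MeasurableSpace G]
  [BorelSpace G] [PolishSpace G] [LocallyCompactSpace G]

theorem continuous_correlation (dg : Measure G) [dg.IsHaarMeasure] {φ : G → ℂ}
    (hφ : Continuous φ) (hφc : HasCompactSupport φ) :
    Continuous (Function.uncurry (correlation dg φ)) := by
  rw [← continuousOn_univ]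
  refine continuousOn_integral_of_compact_support
    (f := fun (p : G × G) (x : G) => conj (φ x) * φ (p.2 * x * p.1)) hφc.isCompact
    (Continuous.continuousOn ?_) fun p x _ hx => ?_
  · simp only [Function.uncurry_def]
    fun_prop
  · rw [image_eq_zero_of_notMem_tsupport hx, map_zero, zero_mul]

/-- Supplies the locally uniform compact support needed to pass from vague convergence to
convergence uniform on compact sets of `g`. -/
theorem exists_isCompact_correlation_eq_zero (dg : Measure G) {φ : G → ℂ}
    (hφc : HasCompactSupport φ) (g₀ : G) :
    ∃ L : Set G, IsCompact L ∧ ∀ᶠ g in 𝓝 g₀, ∀ k ∉ L, correlation dg φ g k = 0 := by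
  obtain ⟨P, hP, hPg⟩ := exists_compact_mem_nhds g₀
  refine ⟨tsupport φ * (tsupport φ * P)⁻¹,
    hφc.isCompact.mul (hφc.isCompact.mul hP).inv, ?_⟩
  filter_upwards [hPg] with g hg k hk
  refine integral_eq_zero_of_ae (Eventually.of_forall fun x => ?_)
  by_cases hx : x ∈ tsupport φ
  · have h1 : φ (k * (x * g)) = 0 := apply_mul_eq_zero_of_notMem (Set.mul_mem_mul hx hg) hk
    simp only [mul_assoc, h1, mul_zero, Pi.zero_apply]
  · simp only [image_eq_zero_of_notMem_tsupport hx, map_zero, zero_mul, Pi.zero_apply]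

/-- Matrix coefficients given by the functions `cosetIntegral Γ m φ` for a tempered subgroup `Γ` are
approximated by those of the regular representation. -/
theorem IsTemperedSubgroup.exists_norm_integral_correlation_sub_lt {Γ : Subgroup G}
    (hΓc : IsClosed (Γ : Set G)) (hΓ : IsTemperedSubgroup Γ) {m : Measure G}
    (hm : IsSubgroupHaar Γ m) (dg : Measure G) [dg.IsHaarMeasure] [dg.IsMulRightInvariant]
    {φ : G → ℂ} (hφ : Continuous φ) (hφc : HasCompactSupport φ)
    {Q : Set G} (hQ : IsCompact Q) {ε : ℝ} (hε : 0 < ε) :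
    ∃ ψ ∈ convexHull ℝ (Set.range (rightTranslationRep (G := G) dg).diagCoeff),
      ∀ g ∈ Q, ‖∫ k, correlation dg φ g k ∂m - ψ g‖ < ε := by
  obtain ⟨μ, hμr, hμf, hμi, hμ0, dg', hdg', hdgr', hdgreg', hdgf', hw⟩ := hΓ
  obtain ⟨β, hβ1, hβ2⟩ := hm.exists_weight
  have hβ : IsCosetWeight m β := ⟨hβ1, hβ2⟩
  -- Temperedness provides some invariant measure; uniqueness identifies it, up to scale, with the
  -- one built from `m`.
  obtain ⟨a, ha, hμa⟩ := hm.exists_eq_smul_quotientMeasure (dg := dg) hΓc hβ μ hμ0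
  have := RightCosets.t2Space hΓc
  have := hm.isFiniteMeasureOnCompacts_quotientMeasure (dg := dg) hΓc hβ
  have hmem : MemLp (cosetIntegral Γ m φ) 2 (quotientMeasure Γ β dg) :=
    (hm.continuous_cosetIntegral hφ hφc).memLp_of_hasCompactSupport
      (hm.hasCompactSupport_cosetIntegral hΓc hφc)
  obtain ⟨w, hwc⟩ := exists_diagCoeff_rightTranslationRep_eq_of_smul (G := G) μ ha hμa hmem
  obtain ⟨ψ, hψ, hψε⟩ := hw w Q hQ ε hε
  refine ⟨ψ, convexHull_mono ?_ hψ, fun g hg => ?_⟩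
  · have h : dg = Measure.haarScalarFactor dg dg' • dg' := Measure.isMulLeftInvariant_eq_smul _ _
    exact range_diagCoeff_rightTranslationRep_subset_of_smul dg dg'
      (Measure.haarScalarFactor_pos_of_isHaarMeasure dg dg').ne' h
  · rw [← hm.integral_conj_cosetIntegral_mul hβ hφ hφc, ← hwc]
    exact hψε g hg

theorem isUnimodularSubgroup_and_isTemperedSubgroup_of_chabautyTendsto
    (Γ : ℕ → Subgroup G) (hΓd : ∀ n, DiscreteTopology (Γ n))
    (hΓ : ∀ n, IsTemperedSubgroup (Γ n)) {H : Subgroup G} (hH : IsClosed (H : Set G))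
    (hlim : ChabautyTendsto Γ H) : IsUnimodularSubgroup H ∧ IsTemperedSubgroup H := by
  obtain ⟨-, -, -, -, -, dg, hdg, hdgr, hdgreg, hdgf, -⟩ := hΓ 0
  obtain ⟨V, hVc, hV⟩ := exists_compact_mem_nhds (1 : G)
  choose m hm hmV using fun n => exists_isSubgroupHaar_of_discrete (Γ n) hV hVc
  have hmf : ∀ n, IsFiniteMeasureOnCompacts (m n) := fun n => (hm n).isFiniteMeasureOnCompacts
  have hb : ∀ L : Set G, IsCompact L → ∃ C : NNReal, ∀ n, m n L ≤ C := fun L hL =>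
    exists_forall_subgroupHaar_le hm hV (fun n => (hmV n).le) hL
  let U : Ultrafilter ℕ := hyperfilter ℕ
  obtain ⟨m₀, hm₀, hconv⟩ := exists_isSubgroupHaar_tendsto_integral hH hlim (U := U)
    Nat.hyperfilter_le_atTop hm hV hVc hmV
  refine ⟨hm₀.isUnimodularSubgroup hH, ?_⟩
  obtain ⟨β, hβ1, hβ2⟩ := hm₀.exists_weight
  have hβ : IsCosetWeight m₀ β := ⟨hβ1, hβ2⟩
  have := RightCosets.t2Space hH
  have := hm₀.isFiniteMeasureOnCompacts_quotientMeasure (dg := dg) hH hβ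
  have hinv := hm₀.smulInvariantMeasure_quotientMeasure (dg := dg) hβ
  have hreg : (quotientMeasure H β dg).Regular := inferInstance
  refine ⟨quotientMeasure H β dg, hreg, inferInstance, hinv, hm₀.quotientMeasure_ne_zero hβ,
    dg, hdg, hdgr, hdgreg, hdgf, fun v Q hQ ε hε => ?_⟩
  have hε3 : 0 < ε / 3 := by positivity
  -- The bound `1` gives `‖w‖ ≤ ‖v‖ + 1` for the approximant `w`; the second bound then makes the
  -- coefficients of `v` and `w` differ by at most `ε / 3`.
  have hη : 0 < min 1 (ε / 3 / (2 * ‖v‖ + 2)) := by positivity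
  obtain ⟨f, hf, hfc, hfm, hfv⟩ :=
    exists_continuous_norm_sub_toLp_le (quotientMeasure H β dg) v hη
  obtain ⟨φ, hφ, hφc, rfl⟩ := hm₀.exists_cosetIntegral_eq hf hfc
  -- One good `n` suffices, so convergence along the ultrafilter is enough.
  obtain ⟨n, hn⟩ := (eventually_forall_norm_integral_sub_lt hmf hm₀.isFiniteMeasureOnCompacts hb
    hconv (continuous_correlation dg hφ hφc) (exists_isCompact_correlation_eq_zero dg hφc)
    hQ hε3).exists
  obtain ⟨ψ, hψ, hψε⟩ := (hΓ n).exists_norm_integral_correlation_sub_lt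
    Subgroup.isClosed_of_discrete (hm n) dg hφ hφc hQ hε3
  refine ⟨ψ, hψ, fun g hg => ?_⟩
  have e2 := hn g hg
  have e3 := hψε g hg
  rw [← hm₀.integral_conj_cosetIntegral_mul hβ hφ hφc,
    ← diagCoeff_rightTranslationRep_toLp _ hfm] at e2
  generalize hfm.toLp _ = w at *
  have e1 : ‖(rightTranslationRep (quotientMeasure H β dg)).diagCoeff v g
      - (rightTranslationRep (quotientMeasure H β dg)).diagCoeff w g‖ ≤ ε / 3 := by
    refine (UnitaryRep.norm_diagCoeff_sub_le _ v w g).trans ?_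
    have h1 : ‖w‖ ≤ ‖v‖ + 1 := by
      have := norm_sub_norm_le w v
      rw [norm_sub_rev] at this
      linarith [hfv.trans (min_le_left _ _)]
    calc ‖v - w‖ * (‖v‖ + ‖w‖) ≤ ε / 3 / (2 * ‖v‖ + 2) * (2 * ‖v‖ + 2) := by
          refine mul_le_mul (hfv.trans (min_le_right _ _)) ?_ (by positivity) (by positivity)
          linarith [norm_nonneg v]
      _ = ε / 3 := div_mul_cancel₀ _ (by positivity)
  rw [← dist_eq_norm] at e1 e2 e3 ⊢
  have t1 := dist_triangle4 ((rightTranslationRep (quotientMeasure H β dg)).diagCoeff v g)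
    ((rightTranslationRep (quotientMeasure H β dg)).diagCoeff w g)
    (∫ k, correlation dg φ g k ∂(m n)) (ψ g)
  linarith

end Main

end

theorem mainTheorem5 {G : Type*} [Group G] [TopologicalSpace G] [IsTopologicalGroup G]
    [MeasurableSpace G] [BorelSpace G]
    (hG : IsConnectedSemisimpleRealAlgebraicGroup G)
    (Γ : ℕ → Subgroup G) (hΓ_discrete : ∀ n, DiscreteTopology (Γ n))
    (hΓ_tempered : ∀ n, IsTemperedSubgroup (Γ n))
    (H : Subgroup G) (hH_closed : IsClosed (H : Set G)) (hlim : ChabautyTendsto Γ H) :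
    IsUnimodularSubgroup H ∧ IsTemperedSubgroup H := by
  obtain ⟨_, _⟩ := hG.polishSpace_and_locallyCompactSpace
  exact isUnimodularSubgroup_and_isTemperedSubgroup_of_chabautyTendsto Γ hΓ_discrete hΓ_tempered
    hH_closed hlim
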